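/- Let $F_r$ be the free group on $x_1,\dots,x_r$, and let $\mathrm{U}_n$ be the group of unitary $n\times n$ complex matrices. For $0<\beta<1$ and $\epsilon>0$, an element $g\in \mathrm{U}_n$ is called $(\beta,\epsilon)$-spread if every arc of the unit circle in $\mathbb{C}$ of Euclidean diameter at most $2\epsilon$ contains at most $(1-\beta)n$ of the eigenvalues of $g$, counted with multiplicity. \textbf{Theorem.} Let $w\in F_r$ be an element whose reduced word has length $\ell\ge 1$, let $0<\beta<1$, let $n$ be an integer with $$n>\max\left\{\frac{4\ell}{1-\beta},\ \frac{8}{1-\beta},\ 16\right\},$$ and let $\mathsf{G}_1,\dots,\mathsf{G}_r$ be independent, Haar-distributed random elements of $\mathrm{U}_n$. Then, for every $\epsilon>0$, $$\mathbb{P}\bigl(w(\mathsf{G}_1,\dots,\mathsf{G}_r)\text{ is not }(\beta,\epsilon)\text{-spread}\bigr)<2^{3n^2}\,\epsilon^{\frac{n^2(1-\beta)^2}{4(\ell+1)}},$$ where $w(\mathsf{G}_1,\dots,\mathsf{G}_r)$ is obtained from $w$ by substituting $x_i\mapsto\mathsf{G}_i$. -/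

import Mathlib

open MeasureTheory ProbabilityTheory

/-- The unitary group `U_n` of complex `n × n` matrices carries its Borel `σ`-algebra. -/
noncomputable instance unitaryGroupMeasurableSpace (n : ℕ) :
    MeasurableSpace (Matrix.unitaryGroup (Fin n) ℂ) :=
  borel _

instance unitaryGroupBorelSpace (n : ℕ) : BorelSpace (Matrix.unitaryGroup (Fin n) ℂ) :=
  ⟨rfl⟩

instance unitaryGroupCompactSpace (n : ℕ) : CompactSpace (Matrix.unitaryGroup (Fin n) ℂ) := by
  have hK : IsCompact (Set.univ.pi fun _ : Fin n => Set.univ.pi fun _ : Fin n =>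
      Metric.closedBall (0 : ℂ) 1) :=
    isCompact_univ_pi fun _ => isCompact_univ_pi fun _ => isCompact_closedBall 0 1
  have hclosed : IsClosed ((Matrix.unitaryGroup (Fin n) ℂ : Set (Matrix (Fin n) (Fin n) ℂ))) :=
    isClosed_unitary
  refine isCompact_iff_compactSpace.mp (hK.of_isClosed_subset hclosed ?_)
  intro U hU i _ j _
  simpa using entry_norm_bound_of_unitary hU i j

/-- The Haar probability measure on `U_n`: the Haar measure giving mass `1` to the whole group. -/
noncomputable def haarUnitary (n : ℕ) : Measure (Matrix.unitaryGroup (Fin n) ℂ) :=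
  Measure.haarMeasure ⊤

instance haarUnitary_isHaarMeasure (n : ℕ) : (haarUnitary n).IsHaarMeasure :=
  inferInstanceAs (Measure.haarMeasure ⊤).IsHaarMeasure

instance haarUnitary_isProbabilityMeasure (n : ℕ) : IsProbabilityMeasure (haarUnitary n) :=
  ⟨by
    simpa [haarUnitary] using
      Measure.haarMeasure_self
        (K₀ := (⊤ : TopologicalSpace.PositiveCompacts (Matrix.unitaryGroup (Fin n) ℂ)))⟩

/-- Arcs of the unit circle `U_1 ⊆ ℂ`: the sets `{e^{iθ} : a ≤ θ ≤ b}` with `a ≤ b`. -/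
def IsArc (A : Set ℂ) : Prop :=
  ∃ a b : ℝ, a ≤ b ∧ A = (fun θ : ℝ => Complex.exp (θ * Complex.I)) '' Set.Icc a b

open Classical in
/-- The number of eigenvalues of a complex matrix, counted with algebraic multiplicity,
that lie in the set `A`. -/
noncomputable def eigenvalueCount {n : ℕ} (g : Matrix (Fin n) (Fin n) ℂ) (A : Set ℂ) : ℕ :=
  g.charpoly.roots.countP (fun z => z ∈ A)

/-- `g ∈ U_n` is `(β, ε)`-spread if at most `(1 - β) n` of its eigenvalues lie in any arc of the
unit circle of (Euclidean) diameter at most `2 ε`. -/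
def IsSpread {n : ℕ} (β ε : ℝ) (g : Matrix.unitaryGroup (Fin n) ℂ) : Prop :=
  ∀ A : Set ℂ, IsArc A → Metric.diam A ≤ 2 * ε →
    (eigenvalueCount (g : Matrix (Fin n) (Fin n) ℂ) A : ℝ) ≤ (1 - β) * n

/-! The proof is a Markov inequality for a product of negative moments. Write `L = ℓ + 1`. If `k`
eigenvalues of `w(g)` lie in a short arc, choose `lam` just outside the unit circle next to the arc.
Then `M = w(g) - lam` satisfies `‖M v‖ ≥ ε ‖v‖` and `|det M| ≤ 3^n ε^k`. Hence the preimage of the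
`ε`-ball under `M` lies in the unit ball and has relative volume `ε^(2n) / |det M|^2`, so for a
uniform `v` in the ball the moment `E ‖M v‖^(-2c)` is at least `ε^(2n-2c) / |det M|^2`
(`le_lintegral_enorm_inv_unitBallMeasure`, `exists_scalar_det_le`).

For the opposite bound, follow `m` random starting vectors along the letters of `w`, and replace `‖M
v‖` by the smaller distance from the end of each trajectory to the span of all earlier points, which
contains `lam v`. The matrices are revealed one image at a time. Conditioned on the images known so
far, the tuple is Haar on a translate of a stabilizer of coordinate flags. The component of the next
point that is still undetermined is then a random direction orthogonal to the known images. Its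
distance to a span `V` has `(-2c)`-th moment at most `8^n` as long as `dim V + c < n`. Distances
multiply along the walk (`IsConditionedHaar.lintegral_le`), and reducedness of `w` guarantees that
the letter about to be applied was not already prescribed at the current point. Each of the `m L`
points thus costs a factor `8^n` (`IsConditionedHaar.lintegral_totalWeight_le`).

With exponents `c_j = n - jL`, the probability is at most `8^(nLm) 9^(nm) ε^(2km - Lm(m+1))`. For `m
= ⌊k/L⌋` the exponent of `ε` is large enough to give the claim whenever the claimed bound is at most
`1`; otherwise there is nothing to prove. -/

/-! ### Haar probability measures of closed subgroups of a compact group -/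

/-- `ν` is the Haar probability measure of the subgroup `H`, regarded as a measure on `G`. -/
structure IsSubgroupHaar {G : Type*} [Group G] [MeasurableSpace G]
    (H : Subgroup G) (ν : Measure G) : Prop where
  prob : IsProbabilityMeasure ν
  ae_mem : ∀ᵐ x ∂ν, x ∈ H
  lintegral_mul_left : ∀ h ∈ H, ∀ f : G → ENNReal, Measurable f →
    ∫⁻ x, f (h * x) ∂ν = ∫⁻ x, f x ∂ν

theorem exists_isSubgroupHaar {G : Type*} [Group G] [TopologicalSpace G] [IsTopologicalGroup G]
    [CompactSpace G] [MeasurableSpace G] [BorelSpace G]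
    (H : Subgroup G) (hH : IsClosed (H : Set G)) :
    ∃ ν : Measure G, IsSubgroupHaar H ν := by
  have : CompactSpace H := isCompact_iff_compactSpace.mp hH.isCompact
  have : IsProbabilityMeasure (Measure.haarMeasure (⊤ : TopologicalSpace.PositiveCompacts H)) :=
    ⟨by simpa using Measure.haarMeasure_self (K₀ := (⊤ : TopologicalSpace.PositiveCompacts H))⟩
  have hm : Measurable (Subtype.val : H → G) := measurable_subtype_coe
  refine ⟨(Measure.haarMeasure (⊤ : TopologicalSpace.PositiveCompacts H)).map Subtype.val,
    Measure.isProbabilityMeasure_map hm.aemeasurable, ?_, ?_⟩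
  · exact (ae_map_iff (p := fun x => x ∈ H) hm.aemeasurable hH.measurableSet).2
      (Filter.Eventually.of_forall fun x => x.2)
  · intro h hh f hf
    have hmul : Measurable fun x : G => h * x := (continuous_const_mul h).measurable
    rw [lintegral_map (f := fun x => f (h * x)) (hf.comp hmul) hm, lintegral_map hf hm]
    exact lintegral_mul_left_eq_self
      (μ := Measure.haarMeasure (⊤ : TopologicalSpace.PositiveCompacts H))
      (fun x : H => f x) ⟨h, hh⟩

namespace IsSubgroupHaar

variable {G : Type*} [Group G] [MeasurableSpace G] [MeasurableMul₂ G] [MeasurableInv G]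
  {H H' : Subgroup G} {ν ν' : Measure G} {f : G → ENNReal}

/-- Integrate `f (x⁻¹ * y)` over both variables: left invariance removes `x` in one order of
integration and `y` in the other. Right invariance, i.e. unimodularity, follows from this. -/
theorem lintegral_inv (hν : IsSubgroupHaar H ν) (hf : Measurable f) :
    ∫⁻ x, f x⁻¹ ∂ν = ∫⁻ x, f x ∂ν := by
  have := hν.prob
  have h1 : ∫⁻ x, ∫⁻ y, f (x⁻¹ * y) ∂ν ∂ν = ∫⁻ x, f x ∂ν := by
    rw [lintegral_congr_ae (g := fun _ => ∫⁻ x, f x ∂ν)]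
    · simp
    · filter_upwards [hν.ae_mem] with x hx
      exact hν.lintegral_mul_left _ (H.inv_mem hx) f hf
  have h2 : ∫⁻ y, ∫⁻ x, f (x⁻¹ * y) ∂ν ∂ν = ∫⁻ x, f x⁻¹ ∂ν := by
    rw [lintegral_congr_ae (g := fun _ => ∫⁻ x, f x⁻¹ ∂ν)]
    · simp
    · filter_upwards [hν.ae_mem] with y hy
      have := hν.lintegral_mul_left _ (H.inv_mem hy) (fun x => f x⁻¹) (hf.comp measurable_inv)
      simpa using this
  rw [← h1, ← h2, lintegral_lintegral_swap]
  exact (hf.comp (measurable_snd.inv.mul measurable_fst)).aemeasurable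

theorem lintegral_mul_right (hν : IsSubgroupHaar H ν) (hf : Measurable f) {h : G} (hh : h ∈ H) :
    ∫⁻ x, f (x * h) ∂ν = ∫⁻ x, f x ∂ν := by
  have h1 := hν.lintegral_inv (f := fun x => f (x * h)) (hf.comp (measurable_mul_const h))
  have h2 := hν.lintegral_mul_left h⁻¹ (H.inv_mem hh) (fun x => f x⁻¹) (hf.comp measurable_inv)
  rw [← h1, ← hν.lintegral_inv hf, ← h2]
  simp

/-- Right translation by elements of `H' ≤ H` preserves `ν`, so averaging over them changes nothing.
For nested stabilizers this conditions on one more image: the outer variable fixes the new image and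
the inner one is the randomness that remains. -/
theorem lintegral_conv (hν : IsSubgroupHaar H ν) (hν' : IsSubgroupHaar H' ν') (hHH : H' ≤ H)
    (hf : Measurable f) :
    ∫⁻ x, f x ∂ν = ∫⁻ x, ∫⁻ y, f (x * y) ∂ν' ∂ν := by
  have := hν.prob
  have := hν'.prob
  have h1 : ∫⁻ y, ∫⁻ x, f (x * y) ∂ν ∂ν' = ∫⁻ x, f x ∂ν := by
    rw [lintegral_congr_ae (g := fun _ => ∫⁻ x, f x ∂ν)]
    · simp
    · filter_upwards [hν'.ae_mem] with y hy
      exact hν.lintegral_mul_right hf (hHH hy)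
  rw [← h1, lintegral_lintegral_swap (f := fun y x => f (x * y))]
  exact (hf.comp (measurable_snd.mul measurable_fst)).aemeasurable

theorem lintegral_eq_of_isMulLeftInvariant (hν : IsSubgroupHaar H ν) (μ : Measure G)
    [IsProbabilityMeasure μ] [μ.IsMulLeftInvariant] (hH : H = ⊤) (hf : Measurable f) :
    ∫⁻ x, f x ∂μ = ∫⁻ x, f x ∂ν := by
  have := hν.prob
  have h1 : ∫⁻ y, ∫⁻ x, f (y * x) ∂μ ∂ν = ∫⁻ x, f x ∂μ := by
    simp_rw [lintegral_mul_left_eq_self f]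
    simp
  rw [← h1, lintegral_lintegral_swap (f := fun y x => f (y * x))
    (hf.comp measurable_mul).aemeasurable]
  have h2 : ∀ x, ∫⁻ y, f (y * x) ∂ν = ∫⁻ y, f y ∂ν :=
    fun x => hν.lintegral_mul_right hf (by simp [hH])
  simp_rw [h2]
  simp

end IsSubgroupHaar

/-! ### The action of the unitary group on Hermitian space -/

/-- The unitary group acts on Hermitian space by linear isometries. -/
noncomputable def unitaryAct (n : ℕ) :
    Matrix.unitaryGroup (Fin n) ℂ ≃*
      (EuclideanSpace ℂ (Fin n) ≃ₗᵢ[ℂ] EuclideanSpace ℂ (Fin n)) :=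
  (Unitary.mapEquiv
    { (Matrix.toEuclideanCLM (n := Fin n) (𝕜 := ℂ)).toRingEquiv.toMulEquiv with
      map_star' := map_star (Matrix.toEuclideanCLM (n := Fin n) (𝕜 := ℂ)) }).toMulEquiv.trans
    Unitary.linearIsometryEquiv

theorem unitaryAct_apply {n : ℕ} (g : Matrix.unitaryGroup (Fin n) ℂ)
    (z : EuclideanSpace ℂ (Fin n)) :
    unitaryAct n g z = Matrix.toEuclideanLin (g : Matrix (Fin n) (Fin n) ℂ) z := rfl

instance (n : ℕ) : SecondCountableTopology (Matrix.unitaryGroup (Fin n) ℂ) := by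
  have : SecondCountableTopology (Matrix (Fin n) (Fin n) ℂ) :=
    inferInstanceAs (SecondCountableTopology (Fin n → Fin n → ℂ))
  exact TopologicalSpace.Subtype.secondCountableTopology _

theorem continuous_unitaryAct (n : ℕ) :
    Continuous fun x : Matrix.unitaryGroup (Fin n) ℂ × EuclideanSpace ℂ (Fin n) =>
      unitaryAct n x.1 x.2 := by
  change Continuous fun x : Matrix.unitaryGroup (Fin n) ℂ × EuclideanSpace ℂ (Fin n) =>
    WithLp.toLp 2 ((x.1 : Matrix (Fin n) (Fin n) ℂ).mulVec x.2.ofLp)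
  fun_prop

attribute [irreducible] unitaryAct

@[fun_prop]
theorem Continuous.unitaryAct_apply {n : ℕ} {X : Type*} [TopologicalSpace X]
    {g : X → Matrix.unitaryGroup (Fin n) ℂ} {z : X → EuclideanSpace ℂ (Fin n)}
    (hg : Continuous g) (hz : Continuous z) : Continuous fun x => unitaryAct n (g x) (z x) := by
  have h : Continuous fun x => (g x, z x) := hg.prodMk hz
  exact (continuous_unitaryAct n).comp h

@[fun_prop]
theorem Measurable.unitaryAct_apply {n : ℕ} {X : Type*} [MeasurableSpace X]
    {g : X → Matrix.unitaryGroup (Fin n) ℂ} {z : X → EuclideanSpace ℂ (Fin n)}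
    (hg : Measurable g) (hz : Measurable z) : Measurable fun x => unitaryAct n (g x) (z x) := by
  have h : Measurable fun x => (g x, z x) := hg.prodMk hz
  exact (continuous_unitaryAct n).measurable.comp h

theorem unitaryAct_mul {n : ℕ} (g h : Matrix.unitaryGroup (Fin n) ℂ)
    (z : EuclideanSpace ℂ (Fin n)) :
    unitaryAct n (g * h) z = unitaryAct n g (unitaryAct n h z) := by
  rw [map_mul]; rfl

theorem unitaryAct_inv_self {n : ℕ} (g : Matrix.unitaryGroup (Fin n) ℂ)
    (z : EuclideanSpace ℂ (Fin n)) :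
    unitaryAct n g⁻¹ (unitaryAct n g z) = z := by
  rw [← unitaryAct_mul]; simp

theorem unitaryAct_self_inv {n : ℕ} (g : Matrix.unitaryGroup (Fin n) ℂ)
    (z : EuclideanSpace ℂ (Fin n)) :
    unitaryAct n g (unitaryAct n g⁻¹ z) = z := by
  rw [← unitaryAct_mul]; simp

/-- A unitary matrix can be prescribed on the coordinate vectors by an orthonormal family. -/
theorem exists_unitaryAct_single_eq {n : ℕ} (v : Fin n → EuclideanSpace ℂ (Fin n))
    (s : Set (Fin n)) (hv : Orthonormal ℂ (s.domRestrict v)) :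
    ∃ g : Matrix.unitaryGroup (Fin n) ℂ, ∀ i ∈ s,
      unitaryAct n g (EuclideanSpace.single i 1) = v i := by
  obtain ⟨b, hb⟩ := hv.exists_orthonormalBasis_extension_of_card_eq (by simp)
  refine ⟨(unitaryAct n).symm ((EuclideanSpace.basisFun (Fin n) ℂ).equiv b (Equiv.refl _)),
    fun i hi => ?_⟩
  rw [MulEquiv.apply_symm_apply, ← EuclideanSpace.basisFun_apply, OrthonormalBasis.equiv_apply_basis,
    Equiv.refl_apply, hb i hi]

/-- The span of the first `d` coordinate vectors. -/
def coordFlag (n d : ℕ) : Submodule ℂ (EuclideanSpace ℂ (Fin n)) where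
  carrier := {z | ∀ i : Fin n, d ≤ i → z i = 0}
  add_mem' := fun {a b} ha hb i hi => by simp [ha i hi, hb i hi]
  zero_mem' := fun i _ => by simp
  smul_mem' := fun c z hz i hi => by simp [hz i hi]

theorem mem_coordFlag {n d : ℕ} {z : EuclideanSpace ℂ (Fin n)} :
    z ∈ coordFlag n d ↔ ∀ i : Fin n, d ≤ i → z i = 0 := Iff.rfl

theorem coordFlag_mono {n d d' : ℕ} (h : d ≤ d') : coordFlag n d ≤ coordFlag n d' :=
  fun _ hz i hi => hz i (h.trans hi)

theorem coordFlag_eq_top {n d : ℕ} (h : n ≤ d) : coordFlag n d = ⊤ :=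
  eq_top_iff.2 fun _ _ i hi => absurd i.2 (by omega)

theorem single_mem_coordFlag {n d : ℕ} {i : Fin n} (h : (i : ℕ) < d) (c : ℂ) :
    EuclideanSpace.single i c ∈ coordFlag n d := fun j hj => by
  have : j ≠ i := by rintro rfl; omega
  simp [this]

theorem sum_single_coord {n : ℕ} (z : EuclideanSpace ℂ (Fin n)) :
    z = ∑ i, z i • EuclideanSpace.single i (1 : ℂ) := by
  ext j
  simp [Finset.sum_apply, Pi.single_apply]

theorem map_eq_self_of_mem_coordFlag {n d : ℕ}
    (T : EuclideanSpace ℂ (Fin n) ≃ₗᵢ[ℂ] EuclideanSpace ℂ (Fin n))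
    (hT : ∀ i : Fin n, (i : ℕ) < d → T (EuclideanSpace.single i 1) = EuclideanSpace.single i 1)
    {z : EuclideanSpace ℂ (Fin n)} (hz : z ∈ coordFlag n d) : T z = z := by
  conv_lhs => rw [sum_single_coord z]
  conv_rhs => rw [sum_single_coord z]
  rw [map_sum]
  refine Finset.sum_congr rfl fun i _ => ?_
  rw [map_smul]
  by_cases hi : (i : ℕ) < d
  · rw [hT i hi]
  · simp [hz i (by omega)]

theorem coordFlag_succ_le {n d : ℕ} (hd : d < n) (W : Submodule ℂ (EuclideanSpace ℂ (Fin n)))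
    (h : coordFlag n d ≤ W) (he : EuclideanSpace.single ⟨d, hd⟩ 1 ∈ W) :
    coordFlag n (d + 1) ≤ W := by
  intro z hz
  rw [sum_single_coord z]
  refine W.sum_mem fun i _ => ?_
  rcases lt_trichotomy (i : ℕ) d with hi | hi | hi
  · exact W.smul_mem _ (h (single_mem_coordFlag hi 1))
  · have : i = ⟨d, hd⟩ := Fin.ext hi
    exact W.smul_mem _ (this ▸ he)
  · simp [hz i hi]

/-- Every vector can be moved into `coordFlag n (d + 1)` by a unitary matrix that fixes
`coordFlag n d`. -/
theorem exists_decomp_coordFlag {n d : ℕ} (hd : d < n) (z : EuclideanSpace ℂ (Fin n)) :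
    ∃ b : Matrix.unitaryGroup (Fin n) ℂ,
      (∀ i : Fin n, (i : ℕ) < d →
        unitaryAct n b (EuclideanSpace.single i 1) = EuclideanSpace.single i 1) ∧
      ∃ z' ∈ coordFlag n d, ∃ τ : ℝ, 0 ≤ τ ∧ τ ≤ ‖z‖ ∧
        z = z' + (τ : ℂ) • unitaryAct n b (EuclideanSpace.single ⟨d, hd⟩ 1) := by
  classical
  set z' : EuclideanSpace ℂ (Fin n) := WithLp.toLp 2 fun i => if (i : ℕ) < d then z i else 0
    with hz'
  have hmem : z' ∈ coordFlag n d := fun i hi => by simp [hz', hi.not_gt]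
  set y := z - z' with hy
  have hy0 : ∀ i : Fin n, (i : ℕ) < d → y i = 0 := fun i hi => by simp [hy, hz', hi]
  have hynorm : ‖y‖ ≤ ‖z‖ := by
    rw [EuclideanSpace.norm_eq, EuclideanSpace.norm_eq]
    refine Real.sqrt_le_sqrt (Finset.sum_le_sum fun i _ => ?_)
    by_cases hi : (i : ℕ) < d
    · simp [hy0 i hi]
    · simp [hy, hz', hi]
  by_cases h0 : y = 0
  · exact ⟨1, fun i _ => by simp, z', hmem, 0, le_rfl, norm_nonneg _,
      by simpa [sub_eq_zero, hy] using h0⟩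
  have hyn : ‖y‖ ≠ 0 := norm_ne_zero_iff.2 h0
  set v : Fin n → EuclideanSpace ℂ (Fin n) := fun i =>
    if (i : ℕ) < d then EuclideanSpace.single i 1 else ((‖y‖ : ℂ)⁻¹) • y with hv
  obtain ⟨b, hb⟩ := exists_unitaryAct_single_eq v {i | (i : ℕ) ≤ d} (by
    rw [orthonormal_iff_ite]
    rintro ⟨i, hi⟩ ⟨j, hj⟩
    simp only [Set.mem_ofPred_eq] at hi hj
    simp only [Set.domRestrict_apply, hv, Subtype.mk.injEq]
    by_cases hi' : (i : ℕ) < d <;> by_cases hj' : (j : ℕ) < d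
    · simp [hi', hj', EuclideanSpace.inner_single_left]
    · have : i ≠ j := by rintro rfl; exact hj' hi'
      simp [hi', hj', EuclideanSpace.inner_single_left, hy0 i hi', this]
    · have : i ≠ j := by rintro rfl; exact hi' hj'
      simp [hi', hj', EuclideanSpace.inner_single_right, hy0 j hj', this]
    · have : i = j := Fin.ext (by omega)
      simp only [hj', if_false, this, if_true]
      rw [inner_self_eq_norm_sq_to_K, norm_smul]
      simp [hyn])
  refine ⟨b, fun i hi => ?_, z', hmem, ‖y‖, norm_nonneg _, hynorm, ?_⟩
  · rw [hb i (le_of_lt hi)]; simp [hv, hi]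
  · rw [hb ⟨d, hd⟩ (le_refl d)]
    have : (‖y‖ : ℂ) ≠ 0 := by exact_mod_cast hyn
    simp only [hv, lt_irrefl, if_false]
    rw [smul_smul, mul_inv_cancel₀ this, one_smul, hy, add_sub_cancel]

/-- Every subspace can be moved into a coordinate flag of the same dimension. -/
theorem exists_map_coordFlag_ge {n d : ℕ} (V : Submodule ℂ (EuclideanSpace ℂ (Fin n)))
    (hV : Module.finrank ℂ V ≤ d) :
    ∃ g : Matrix.unitaryGroup (Fin n) ℂ, ∀ z ∈ V, unitaryAct n g⁻¹ z ∈ coordFlag n d := by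
  classical
  set f := Module.finrank ℂ V with hf
  have hfn : f ≤ n := by simpa using Submodule.finrank_le V
  let bV := stdOrthonormalBasis ℂ V
  set v : Fin n → EuclideanSpace ℂ (Fin n) := fun i =>
    if h : (i : ℕ) < f then (bV ⟨i, h⟩ : EuclideanSpace ℂ (Fin n)) else 0 with hv
  obtain ⟨g, hg⟩ := exists_unitaryAct_single_eq v {i | (i : ℕ) < f} (by
    rw [orthonormal_iff_ite]
    rintro ⟨i, hi⟩ ⟨j, hj⟩
    simp only [Set.mem_ofPred_eq] at hi hj
    simp only [Set.domRestrict_apply, hv, hi, hj, dif_pos, Subtype.mk.injEq]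
    rw [← Submodule.coe_inner, orthonormal_iff_ite.1 bV.orthonormal]
    simp [Fin.ext_iff])
  refine ⟨g, fun z hz => ?_⟩
  have hz' : z = ∑ i, (bV.repr ⟨z, hz⟩ i) • (bV i : EuclideanSpace ℂ (Fin n)) := by
    conv_lhs => rw [show z = ((⟨z, hz⟩ : V) : EuclideanSpace ℂ (Fin n)) from rfl,
      ← bV.sum_repr ⟨z, hz⟩]
    simp
  rw [hz', map_sum]
  refine Submodule.sum_mem _ fun i _ => ?_
  rw [map_smul]
  refine Submodule.smul_mem _ _ ?_
  have hi : (i : ℕ) < f := i.2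
  have h1 := hg ⟨i, hi.trans_le hfn⟩ hi
  simp only [hv, hi, dif_pos] at h1
  rw [show bV i = bV ⟨i, hi⟩ from rfl, ← h1, unitaryAct_inv_self]
  exact single_mem_coordFlag (n := n) (i := ⟨i, hi.trans_le hfn⟩) (hi.trans_le hV) 1

/-! ### The uniform measure on the unit ball of Hermitian space -/

/-- The uniform probability measure on the closed unit ball of `ℂⁿ`. -/
noncomputable def unitBallMeasure (n : ℕ) : Measure (EuclideanSpace ℂ (Fin n)) :=
  volume[|Metric.closedBall 0 1]

theorem volume_closedBall_one_ne_zero (n : ℕ) :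
    (volume : Measure (EuclideanSpace ℂ (Fin n))) (Metric.closedBall 0 1) ≠ 0 :=
  (Metric.measure_closedBall_pos volume _ one_pos).ne'

theorem volume_closedBall_one_ne_top (n : ℕ) :
    (volume : Measure (EuclideanSpace ℂ (Fin n))) (Metric.closedBall 0 1) ≠ ⊤ :=
  measure_closedBall_lt_top.ne

instance (n : ℕ) : IsProbabilityMeasure (unitBallMeasure n) :=
  cond_isProbabilityMeasure_of_finite (volume_closedBall_one_ne_zero n)
    (volume_closedBall_one_ne_top n)

theorem unitBallMeasure_apply {n : ℕ} (s : Set (EuclideanSpace ℂ (Fin n))) :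
    unitBallMeasure n s = (volume (Metric.closedBall (0 : EuclideanSpace ℂ (Fin n)) 1))⁻¹ *
      volume (Metric.closedBall 0 1 ∩ s) :=
  cond_apply measurableSet_closedBall _ _

theorem ae_unitBallMeasure_norm_le (n : ℕ) : ∀ᵐ z ∂unitBallMeasure n, ‖z‖ ≤ 1 := by
  have := ae_cond_mem (μ := volume) (s := Metric.closedBall (0 : EuclideanSpace ℂ (Fin n)) 1)
    measurableSet_closedBall
  filter_upwards [this] with z hz
  simpa using hz

theorem volume_preimage_toEuclideanLin {n : ℕ} {M : Matrix (Fin n) (Fin n) ℂ} (hM : M.det ≠ 0)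
    (s : Set (EuclideanSpace ℂ (Fin n))) :
    volume (Matrix.toEuclideanLin M ⁻¹' s) = ENNReal.ofReal (‖M.det‖ ^ 2)⁻¹ * volume s := by
  have hdet : LinearMap.det ((Matrix.toEuclideanLin M).restrictScalars ℝ) = ‖M.det‖ ^ 2 := by
    rw [LinearMap.det_restrictScalars, Algebra.norm_complex_apply, Matrix.toEuclideanLin,
      LinearMap.det_toLpLin, Complex.normSq_eq_norm_sq]
  have hne : LinearMap.det ((Matrix.toEuclideanLin M).restrictScalars ℝ) ≠ 0 := by
    rw [hdet]; exact pow_ne_zero _ (norm_ne_zero_iff.2 hM)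
  have h := Measure.addHaar_preimage_linearMap volume hne s
  rw [hdet, abs_of_nonneg (by positivity)] at h
  exact h

theorem measurePreserving_unitaryAct {n : ℕ} (g : Matrix.unitaryGroup (Fin n) ℂ) :
    MeasurePreserving (unitaryAct n g) volume volume := by
  refine ⟨(unitaryAct n g).continuous.measurable, Measure.ext fun s hs => ?_⟩
  rw [Measure.map_apply (unitaryAct n g).continuous.measurable hs]
  have h1 : ‖(g : Matrix (Fin n) (Fin n) ℂ).det‖ = 1 :=
    CStarRing.norm_of_mem_unitary (Matrix.det_of_mem_unitary g.2)
  have h := volume_preimage_toEuclideanLin (M := (g : Matrix (Fin n) (Fin n) ℂ))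
    (norm_ne_zero_iff.1 (by rw [h1]; exact one_ne_zero)) s
  rw [h1] at h
  rw [show ⇑(unitaryAct n g) = ⇑(Matrix.toEuclideanLin (g : Matrix (Fin n) (Fin n) ℂ)) from
    funext (unitaryAct_apply g)]
  simpa using h

theorem lintegral_unitBallMeasure_unitaryAct {n : ℕ} (g : Matrix.unitaryGroup (Fin n) ℂ)
    {f : EuclideanSpace ℂ (Fin n) → ENNReal} (hf : Measurable f) :
    ∫⁻ z, f (unitaryAct n g z) ∂unitBallMeasure n = ∫⁻ z, f z ∂unitBallMeasure n := by
  rw [unitBallMeasure, ProbabilityTheory.cond, lintegral_smul_measure, lintegral_smul_measure]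
  congr 1
  have hpre : unitaryAct n g ⁻¹' Metric.closedBall 0 1 = Metric.closedBall 0 1 := by
    ext z; simp
  have h := (measurePreserving_unitaryAct g).setLIntegral_comp_preimage
    (measurableSet_closedBall (x := 0) (ε := 1)) hf
  rwa [hpre] at h

theorem volume_closedBall_eq {n : ℕ} {t : ℝ} (ht : 0 ≤ t) :
    volume (Metric.closedBall (0 : EuclideanSpace ℂ (Fin n)) t) =
      ENNReal.ofReal (t ^ (2 * n)) *
        volume (Metric.closedBall (0 : EuclideanSpace ℂ (Fin n)) 1) := by
  rw [Measure.addHaar_closedBall' _ _ ht, finrank_real_of_complex]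
  simp

/-- Lower bound for a negative moment of `‖M v‖` in terms of the determinant of `M`. -/
theorem le_lintegral_enorm_inv_unitBallMeasure {n : ℕ} {M : Matrix (Fin n) (Fin n) ℂ}
    (hM : M.det ≠ 0) {ε : ℝ} (hε : 0 < ε)
    (hMε : ∀ v, ε * ‖v‖ ≤ ‖Matrix.toEuclideanLin M v‖) (c : ℕ) :
    ENNReal.ofReal (ε ^ (2 * n) * (ε ^ (2 * c))⁻¹ * (‖M.det‖ ^ 2)⁻¹) ≤
      ∫⁻ v, (‖Matrix.toEuclideanLin M v‖ₑ ^ (2 * c))⁻¹ ∂unitBallMeasure n := by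
  set S : Set (EuclideanSpace ℂ (Fin n)) := Matrix.toEuclideanLin M ⁻¹' Metric.closedBall 0 ε
    with hS
  have hcont : Continuous (Matrix.toEuclideanLin M) := LinearMap.continuous_of_finiteDimensional _
  have hSm : MeasurableSet S := hcont.measurable measurableSet_closedBall
  -- The expansion bound keeps the whole preimage of the `ε`-ball inside the unit ball, so its
  -- measure is given exactly by the determinant.
  have hSB : S ⊆ Metric.closedBall 0 1 := by
    intro v hv
    have h1 : ‖Matrix.toEuclideanLin M v‖ ≤ ε := by simpa [hS] using hv
    have h2 := (hMε v).trans h1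
    rw [mem_closedBall_zero_iff]
    exact (mul_le_iff_le_one_right hε).1 h2
  have hmeas : unitBallMeasure n S =
      ENNReal.ofReal (‖M.det‖ ^ 2)⁻¹ * ENNReal.ofReal (ε ^ (2 * n)) := by
    rw [unitBallMeasure_apply, Set.inter_eq_right.2 hSB, hS, volume_preimage_toEuclideanLin hM,
      volume_closedBall_eq hε.le, mul_comm, mul_assoc, mul_assoc,
      ENNReal.mul_inv_cancel (volume_closedBall_one_ne_zero n) (volume_closedBall_one_ne_top n),
      mul_one]
  calc ENNReal.ofReal (ε ^ (2 * n) * (ε ^ (2 * c))⁻¹ * (‖M.det‖ ^ 2)⁻¹)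
      = ENNReal.ofReal (ε ^ (2 * c))⁻¹ * unitBallMeasure n S := by
        rw [hmeas, ← ENNReal.ofReal_mul (by positivity), ← ENNReal.ofReal_mul (by positivity)]
        congr 1; ring
    _ = ∫⁻ _ in S, ENNReal.ofReal (ε ^ (2 * c))⁻¹ ∂unitBallMeasure n := by simp
    _ ≤ ∫⁻ v in S, (‖Matrix.toEuclideanLin M v‖ₑ ^ (2 * c))⁻¹ ∂unitBallMeasure n := by
        refine setLIntegral_mono' hSm fun v hv => ?_
        have h1 : ‖Matrix.toEuclideanLin M v‖ ≤ ε := by simpa [hS] using hv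
        rw [ENNReal.ofReal_inv_of_pos (by positivity), ENNReal.ofReal_pow hε.le]
        gcongr
        rw [← ofReal_norm]
        exact ENNReal.ofReal_le_ofReal h1
    _ ≤ _ := setLIntegral_le_lintegral _ _

/-- Dividing the last `q` coordinates by `t` sends the set into the ball of radius `√2`. Each
complex coordinate rescales volume by `t^2`, and the radius contributes `(√2)^(2n) = 2^n`. -/
theorem unitBallMeasure_infEDist_coordFlag_le {n d q : ℕ} (hdq : d + q = n) {t : ℝ} (ht : 0 < t) :
    unitBallMeasure n {z | Metric.infEDist z (coordFlag n d) ≤ ENNReal.ofReal t} ≤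
      ENNReal.ofReal (2 ^ n * t ^ (2 * q)) := by
  classical
  set M : Matrix (Fin n) (Fin n) ℂ := Matrix.diagonal fun i => if (i : ℕ) < d then 1 else (t : ℂ)⁻¹
    with hMdef
  have ht' : (t : ℂ) ≠ 0 := by exact_mod_cast ht.ne'
  have hcard : (Finset.univ.filter fun i : Fin n => ¬ (i : ℕ) < d).card = q := by
    have h1 := Finset.card_filter_add_card_filter_not (s := (Finset.univ : Finset (Fin n)))
      (fun i : Fin n => (i : ℕ) < d)
    have h2 : (Finset.univ.filter fun i : Fin n => (i : ℕ) < d).card = d := by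
      rw [Fin.card_filter_val_lt]; omega
    simp only [Finset.card_univ, Fintype.card_fin] at h1
    omega
  have hdet : M.det = (t : ℂ)⁻¹ ^ q := by
    rw [hMdef, Matrix.det_diagonal, Finset.prod_ite]
    simp only [Finset.prod_const, one_pow, one_mul, hcard]
  have hdet0 : M.det ≠ 0 := by rw [hdet]; exact pow_ne_zero _ (inv_ne_zero ht')
  have hsub : Metric.closedBall 0 1 ∩
      {z | Metric.infEDist z (coordFlag n d : Set (EuclideanSpace ℂ (Fin n))) ≤ ENNReal.ofReal t} ⊆
      Matrix.toEuclideanLin M ⁻¹' Metric.closedBall 0 (√2) := by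
    rintro z ⟨hz1, hz2⟩
    have hz1 : ‖z‖ ≤ 1 := by simpa using hz1
    have hMz : ∀ i, Matrix.toEuclideanLin M z i = (if (i : ℕ) < d then 1 else (t : ℂ)⁻¹) * z i := by
      intro i
      change (M.mulVec z.ofLp) i = _
      rw [hMdef, Matrix.mulVec_diagonal]
    set x : EuclideanSpace ℂ (Fin n) := WithLp.toLp 2 fun i => if (i : ℕ) < d then 0 else z i
      with hx
    have hxt : ‖x‖ ≤ t := by
      have h1 : ENNReal.ofReal ‖x‖ ≤
          Metric.infEDist z (coordFlag n d : Set (EuclideanSpace ℂ (Fin n))) := by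
        refine Metric.le_infEDist.2 fun y hy => ?_
        rw [edist_dist, dist_eq_norm]
        refine ENNReal.ofReal_le_ofReal ?_
        rw [EuclideanSpace.norm_eq, EuclideanSpace.norm_eq]
        refine Real.sqrt_le_sqrt (Finset.sum_le_sum fun i _ => ?_)
        by_cases hi : (i : ℕ) < d
        · simp [hx, hi]
        · simp [hx, hi, mem_coordFlag.1 hy i (not_lt.1 hi)]
      exact (ENNReal.ofReal_le_ofReal_iff ht.le).1 (h1.trans hz2)
    have hsum : ‖Matrix.toEuclideanLin M z‖ ^ 2 ≤ ‖z‖ ^ 2 + (t⁻¹ * ‖x‖) ^ 2 := by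
      rw [mul_pow, EuclideanSpace.norm_sq_eq, EuclideanSpace.norm_sq_eq, EuclideanSpace.norm_sq_eq,
        Finset.mul_sum, ← Finset.sum_add_distrib]
      refine Finset.sum_le_sum fun i _ => ?_
      rw [hMz i]
      by_cases hi : (i : ℕ) < d
      · simp [hi, hx]
      · simp only [hi, hx, if_false, norm_mul, norm_inv, Complex.norm_real, mul_pow,
          Real.norm_eq_abs, abs_of_pos ht]
        nlinarith [sq_nonneg ‖z i‖]
    have hle : t⁻¹ * ‖x‖ ≤ 1 := by
      rw [inv_mul_le_iff₀ ht]; simpa using hxt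
    have hnn : 0 ≤ t⁻¹ * ‖x‖ := by positivity
    rw [Set.mem_preimage, mem_closedBall_zero_iff]
    refine Real.le_sqrt_of_sq_le ?_
    nlinarith [norm_nonneg z]
  have hvol := measure_mono (μ := volume) hsub
  rw [volume_preimage_toEuclideanLin hdet0, volume_closedBall_eq (Real.sqrt_nonneg 2)] at hvol
  rw [unitBallMeasure_apply]
  calc _ ≤ (volume (Metric.closedBall (0 : EuclideanSpace ℂ (Fin n)) 1))⁻¹ *
        (ENNReal.ofReal (‖M.det‖ ^ 2)⁻¹ * (ENNReal.ofReal (√2 ^ (2 * n)) *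
          volume (Metric.closedBall (0 : EuclideanSpace ℂ (Fin n)) 1))) := by gcongr
    _ = ENNReal.ofReal (‖M.det‖ ^ 2)⁻¹ * ENNReal.ofReal (√2 ^ (2 * n)) := by
        rw [mul_comm, mul_assoc, mul_assoc,
          ENNReal.mul_inv_cancel (volume_closedBall_one_ne_zero n)
            (volume_closedBall_one_ne_top n), mul_one]
    _ = _ := by
        rw [← ENNReal.ofReal_mul (by positivity), hdet, norm_pow, norm_inv, Complex.norm_real,
          Real.norm_eq_abs, abs_of_pos ht, pow_mul (√2), Real.sq_sqrt (by norm_num)]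
        congr 1
        rw [← pow_mul, inv_pow, inv_inv, mul_comm q 2, mul_comm]

/-- The single term with `2^-(i+1) < X ≤ 2^-i` already dominates. At `X = 0` every term is at least
`1`, so the sum is infinite. -/
theorem inv_pow_le_tsum_dyadic {X : ENNReal} (hX : X ≤ 1) (c : ℕ) :
    (X ^ (2 * c))⁻¹ ≤
      ∑' i : ℕ, (4 : ENNReal) ^ ((i + 1) * c) *
        Set.indicator (Set.Iic (ENNReal.ofReal ((1 / 2) ^ i))) 1 X := by
  by_cases h0 : X = 0
  · subst h0
    have : (⊤ : ENNReal) ≤ ∑' i : ℕ, (4 : ENNReal) ^ ((i + 1) * c) *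
        Set.indicator (Set.Iic (ENNReal.ofReal ((1 / 2) ^ i))) 1 0 := by
      rw [← ENNReal.tsum_const_eq_top_of_ne_zero (α := ℕ) (c := 1) one_ne_zero]
      refine ENNReal.tsum_le_tsum fun i => ?_
      simpa using one_le_pow₀ (M₀ := ENNReal) (a := 4) (n := (i + 1) * c) (by norm_num)
    exact le_top.trans this
  · have hXt : X ≠ ⊤ := ne_top_of_le_ne_top ENNReal.one_ne_top hX
    have hx0 : 0 < X.toReal := ENNReal.toReal_pos h0 hXt
    have hx1 : X.toReal ≤ 1 := by simpa using ENNReal.toReal_mono ENNReal.one_ne_top hX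
    obtain ⟨i, hi1, hi2⟩ := exists_nat_pow_near_of_lt_one hx0 hx1
      (by norm_num : (0 : ℝ) < 1 / 2) (by norm_num)
    refine le_trans ?_ (ENNReal.le_tsum i)
    have hmem : X ≤ ENNReal.ofReal ((1 / 2) ^ i) := by
      rw [← ENNReal.ofReal_toReal hXt]; exact ENNReal.ofReal_le_ofReal hi2
    rw [Set.indicator_of_mem (Set.mem_Iic.2 hmem), Pi.one_apply, mul_one, ENNReal.inv_le_iff_inv_le,
      ← ENNReal.ofReal_toReal hXt, ← ENNReal.ofReal_pow hx0.le,
      show (4 : ENNReal) = ENNReal.ofReal 4 by simp, ← ENNReal.ofReal_pow (by norm_num),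
      ← ENNReal.ofReal_inv_of_pos (by positivity)]
    refine ENNReal.ofReal_le_ofReal ?_
    calc ((4 : ℝ) ^ ((i + 1) * c))⁻¹ = ((1 / 2) ^ (i + 1)) ^ (2 * c) := by
          rw [← pow_mul, one_div, inv_pow]
          congr 1
          rw [show (4 : ℝ) = 2 ^ 2 by norm_num, ← pow_mul]
          congr 1; ring
      _ ≤ X.toReal ^ (2 * c) := by gcongr

/-- Negative moments of the distance to a subspace are bounded as long as the codimension
exceeds half of the exponent. -/
theorem lintegral_infEDist_inv_unitBallMeasure_le {n c : ℕ}
    (V : Submodule ℂ (EuclideanSpace ℂ (Fin n))) (hV : Module.finrank ℂ V + c + 1 ≤ n) :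
    ∫⁻ z, (Metric.infEDist z V ^ (2 * c))⁻¹ ∂unitBallMeasure n ≤ 8 ^ n := by
  -- After a rotation, `V` is enlarged to a coordinate flag of codimension exactly `c + 1`, which
  -- only decreases distances.
  obtain ⟨g, hg⟩ := exists_map_coordFlag_ge (d := n - c - 1) V (by omega)
  set F : Set (EuclideanSpace ℂ (Fin n)) := SetLike.coe (coordFlag n (n - c - 1))
  have hle : ∀ z, Metric.infEDist (unitaryAct n g⁻¹ z) F ≤ Metric.infEDist z V := by
    intro z
    refine Metric.le_infEDist.2 fun y hy => ?_
    rw [← (unitaryAct n g⁻¹).edist_map z y]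
    exact Metric.infEDist_le_edist_of_mem (hg y hy)
  have hmeas : Measurable fun z => (Metric.infEDist z F ^ (2 * c))⁻¹ :=
    (Metric.continuous_infEDist.measurable.pow_const _).inv
  have hset : ∀ i : ℕ, MeasurableSet {z | Metric.infEDist z F ≤ ENNReal.ofReal ((1 / 2) ^ i)} :=
    fun i => measurableSet_le Metric.continuous_infEDist.measurable measurable_const
  calc ∫⁻ z, (Metric.infEDist z V ^ (2 * c))⁻¹ ∂unitBallMeasure n
      ≤ ∫⁻ z, (Metric.infEDist (unitaryAct n g⁻¹ z) F ^ (2 * c))⁻¹ ∂unitBallMeasure n := by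
        refine lintegral_mono fun z => ?_
        have := hle z
        gcongr
    _ = ∫⁻ z, (Metric.infEDist z F ^ (2 * c))⁻¹ ∂unitBallMeasure n :=
        lintegral_unitBallMeasure_unitaryAct g⁻¹ hmeas
    _ ≤ ∫⁻ z, ∑' i : ℕ, (4 : ENNReal) ^ ((i + 1) * c) *
          Set.indicator {z | Metric.infEDist z F ≤ ENNReal.ofReal ((1 / 2) ^ i)} 1 z
            ∂unitBallMeasure n := by
        refine lintegral_mono_ae ?_
        filter_upwards [ae_unitBallMeasure_norm_le n] with z hz
        refine (inv_pow_le_tsum_dyadic (X := Metric.infEDist z F) ?_ c).trans_eq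
          (tsum_congr fun i => by simp [Set.indicator_apply])
        refine (Metric.infEDist_le_edist_of_mem (y := 0) (Submodule.zero_mem _)).trans ?_
        rw [edist_dist, dist_zero_right]
        exact ENNReal.ofReal_le_one.2 hz
    _ = ∑' i : ℕ, (4 : ENNReal) ^ ((i + 1) * c) *
          unitBallMeasure n {z | Metric.infEDist z F ≤ ENNReal.ofReal ((1 / 2) ^ i)} := by
        rw [lintegral_tsum]
        · refine tsum_congr fun i => ?_
          rw [lintegral_const_mul _ (measurable_one.indicator (hset i)),
            lintegral_indicator_one (hset i)]
        · exact fun i => ((measurable_one.indicator (hset i)).const_mul _).aemeasurable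
    -- The measure of the `i`-th set is at most `2^n 4^(-i(c+1))`; the one codimension beyond `c`
    -- leaves a convergent geometric series.
    _ ≤ ∑' i : ℕ, ENNReal.ofReal (4 ^ c * 2 ^ n) * (ENNReal.ofReal (1 / 4)) ^ i := by
        refine ENNReal.tsum_le_tsum fun i => ?_
        refine (mul_le_mul_right (unitBallMeasure_infEDist_coordFlag_le
          (q := c + 1) (by omega) (by positivity)) _).trans_eq ?_
        rw [show (4 : ENNReal) = ENNReal.ofReal 4 by simp, ← ENNReal.ofReal_pow (by norm_num),
          ← ENNReal.ofReal_pow (by norm_num), ← ENNReal.ofReal_mul (by positivity),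
          ← ENNReal.ofReal_mul (by positivity)]
        congr 1
        have e1 : ((1 / 2 : ℝ) ^ i) ^ (2 * (c + 1)) = (1 / 4) ^ (i * c) * (1 / 4) ^ i := by
          rw [← pow_mul, ← pow_add, show (1 / 4 : ℝ) = (1 / 2) ^ 2 by norm_num, ← pow_mul]
          congr 1; ring
        rw [e1, add_mul, pow_add, one_mul, one_div_pow 4 (i * c)]
        field_simp
    _ ≤ 8 ^ n := by
        rw [ENNReal.tsum_mul_left, ENNReal.tsum_geometric]
        -- The value is `4/3`; the cruder `4` merges with `4^c` into `4^(c+1) ≤ 4^n`.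
        have h1 : (1 - ENNReal.ofReal (1 / 4))⁻¹ ≤ ENNReal.ofReal 4 := by
          rw [ENNReal.inv_le_iff_inv_le, ← ENNReal.ofReal_inv_of_pos (by norm_num),
            ← ENNReal.ofReal_one, ← ENNReal.ofReal_sub _ (by norm_num)]
          exact ENNReal.ofReal_le_ofReal (by norm_num)
        refine (mul_le_mul_right h1 _).trans ?_
        rw [← ENNReal.ofReal_mul (by positivity), show (8 : ENNReal) = ENNReal.ofReal 8 by simp,
          ← ENNReal.ofReal_pow (by norm_num)]
        refine ENNReal.ofReal_le_ofReal ?_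
        calc (4 : ℝ) ^ c * 2 ^ n * 4 = 4 ^ (c + 1) * 2 ^ n := by ring
          _ ≤ 4 ^ n * 2 ^ n := by
            gcongr
            · norm_num
            · omega
          _ = 8 ^ n := by rw [← mul_pow]; norm_num

/-! ### Haar measures on tuples of unitary matrices with prescribed action on subspaces -/

/-- The tuples of unitary matrices whose `a`-th entry fixes the first `d a` coordinate vectors. -/
def flagStabilizer (n : ℕ) {r : ℕ} (d : Fin r → ℕ) :
    Subgroup (Fin r → Matrix.unitaryGroup (Fin n) ℂ) where
  carrier := {g | ∀ a, ∀ i : Fin n, (i : ℕ) < d a →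
    unitaryAct n (g a) (EuclideanSpace.single i 1) = EuclideanSpace.single i 1}
  mul_mem' := fun {g h} hg hh a i hi => by
    rw [Pi.mul_apply, unitaryAct_mul, hh a i hi, hg a i hi]
  one_mem' := fun a i _ => by simp
  inv_mem' := fun {g} hg a i hi => by
    conv_lhs => rw [← hg a i hi]
    exact unitaryAct_inv_self _ _

theorem isClosed_flagStabilizer (n : ℕ) {r : ℕ} (d : Fin r → ℕ) :
    IsClosed (flagStabilizer n d : Set (Fin r → Matrix.unitaryGroup (Fin n) ℂ)) := by
  have : (flagStabilizer n d : Set (Fin r → Matrix.unitaryGroup (Fin n) ℂ)) =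
      ⋂ (a : Fin r) (i : Fin n) (_ : (i : ℕ) < d a), {g |
        unitaryAct n (g a) (EuclideanSpace.single i 1) = EuclideanSpace.single i 1} := by
    ext g
    simp only [Set.mem_iInter]
    exact Iff.rfl
  rw [this]
  refine isClosed_iInter fun a => isClosed_iInter fun i => isClosed_iInter fun _ => ?_
  exact isClosed_eq (by fun_prop) continuous_const

theorem flagStabilizer_anti {n r : ℕ} {d d' : Fin r → ℕ} (h : d ≤ d') :
    flagStabilizer n d' ≤ flagStabilizer n d :=
  fun _ hg a i hi => hg a i (hi.trans_le (h a))

theorem unitaryAct_eq_self_of_mem_flagStabilizer {n r : ℕ} {d : Fin r → ℕ}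
    {g : Fin r → Matrix.unitaryGroup (Fin n) ℂ} (hg : g ∈ flagStabilizer n d) (a : Fin r)
    {z : EuclideanSpace ℂ (Fin n)} (hz : z ∈ coordFlag n (d a)) : unitaryAct n (g a) z = z :=
  map_eq_self_of_mem_coordFlag _ (hg a) hz

/-- The Haar probability measure of `flagStabilizer n d`, as a measure on tuples. -/
noncomputable def flagHaar (n : ℕ) {r : ℕ} (d : Fin r → ℕ) :
    Measure (Fin r → Matrix.unitaryGroup (Fin n) ℂ) :=
  (exists_isSubgroupHaar _ (isClosed_flagStabilizer n d)).choose

theorem isSubgroupHaar_flagHaar (n : ℕ) {r : ℕ} (d : Fin r → ℕ) :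
    IsSubgroupHaar (flagStabilizer n d) (flagHaar n d) :=
  (exists_isSubgroupHaar _ (isClosed_flagStabilizer n d)).choose_spec

instance (n : ℕ) {r : ℕ} (d : Fin r → ℕ) : IsProbabilityMeasure (flagHaar n d) :=
  (isSubgroupHaar_flagHaar n d).prob

theorem mulSingle_mem_flagStabilizer {n r : ℕ} {d : Fin r → ℕ} {a : Fin r}
    {b : Matrix.unitaryGroup (Fin n) ℂ}
    (hb : ∀ i : Fin n, (i : ℕ) < d a →
      unitaryAct n b (EuclideanSpace.single i 1) = EuclideanSpace.single i 1) :
    Pi.mulSingle a b ∈ flagStabilizer n d := by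
  intro a' i hi
  by_cases h : a' = a
  · subst h; simpa using hb i hi
  · simp [h]

theorem infEDist_add_smul_le {n : ℕ} (V : Submodule ℂ (EuclideanSpace ℂ (Fin n)))
    {z' x : EuclideanSpace ℂ (Fin n)} (hz' : z' ∈ V) {τ : ℝ} (h0 : 0 ≤ τ) (h1 : τ ≤ 1) :
    Metric.infEDist (z' + (τ : ℂ) • x) V ≤ Metric.infEDist x V := by
  refine Metric.le_infEDist.2 fun y hy => ?_
  refine (Metric.infEDist_le_edist_of_mem
    (V.add_mem hz' (V.smul_mem (τ : ℂ) hy))).trans ?_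
  rw [edist_dist, edist_dist, dist_add_left, dist_smul₀]
  refine ENNReal.ofReal_le_ofReal (mul_le_of_le_one_left dist_nonneg ?_)
  simpa [abs_of_nonneg h0] using h1

theorem mul_infEDist_le_infEDist_add_smul {n : ℕ} (V : Submodule ℂ (EuclideanSpace ℂ (Fin n)))
    {z' x : EuclideanSpace ℂ (Fin n)} (hz' : z' ∈ V) {τ : ℝ} (h0 : 0 ≤ τ) :
    ENNReal.ofReal τ * Metric.infEDist x V ≤ Metric.infEDist (z' + (τ : ℂ) • x) V := by
  rcases h0.eq_or_lt with rfl | h0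
  · simp
  have hτ : (τ : ℂ) ≠ 0 := by exact_mod_cast h0.ne'
  refine Metric.le_infEDist.2 fun y hy => ?_
  have hmem : (τ : ℂ)⁻¹ • (y - z') ∈ V := V.smul_mem _ (V.sub_mem hy hz')
  have h := Metric.infEDist_le_edist_of_mem (x := x) (s := (V : Set _)) hmem
  refine (mul_le_mul_right h _).trans_eq ?_
  have e : y = z' + (τ : ℂ) • ((τ : ℂ)⁻¹ • (y - z')) := by
    rw [smul_smul, mul_inv_cancel₀ hτ, one_smul, add_sub_cancel]
  conv_rhs => rw [e]
  rw [edist_dist, edist_dist, dist_add_left, dist_smul₀, ENNReal.ofReal_mul (norm_nonneg _)]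
  simp [abs_of_pos h0]

theorem measurable_infEDist_unitaryAct_inv {n : ℕ} {X : Type*} [MeasurableSpace X]
    {g : X → Matrix.unitaryGroup (Fin n) ℂ} {z : X → EuclideanSpace ℂ (Fin n)}
    (hg : Measurable g) (hz : Measurable z) (V : Submodule ℂ (EuclideanSpace ℂ (Fin n))) (c : ℕ) :
    Measurable fun x => (Metric.infEDist (unitaryAct n (g x) (z x)) V ^ (2 * c))⁻¹ := by
  have h : Measurable fun x => Metric.infEDist (unitaryAct n (g x) (z x))
      (V : Set (EuclideanSpace ℂ (Fin n))) :=
    Metric.continuous_infEDist.measurable.comp (hg.unitaryAct_apply hz)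
  exact (h.pow_const _).inv

/-- A random vector, uniform in the orthogonal complement of a coordinate flag, has bounded
negative moments of its distance to a subspace containing the flag. -/
theorem lintegral_infEDist_inv_flagHaar_le {n r c : ℕ} {d : Fin r → ℕ} {a : Fin r} (hd : d a < n)
    (V : Submodule ℂ (EuclideanSpace ℂ (Fin n))) (hdV : coordFlag n (d a) ≤ V)
    (hV : Module.finrank ℂ V + c + 1 ≤ n) :
    ∫⁻ σ, (Metric.infEDist (unitaryAct n (σ a) (EuclideanSpace.single ⟨d a, hd⟩ 1)) V
      ^ (2 * c))⁻¹ ∂flagHaar n d ≤ 8 ^ n := by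
  set f : EuclideanSpace ℂ (Fin n) → ENNReal := fun z => (Metric.infEDist z V ^ (2 * c))⁻¹ with hf
  have hfm : Measurable f := (Metric.continuous_infEDist.measurable.pow_const _).inv
  have hν := isSubgroupHaar_flagHaar n d
  have hfσ : ∀ z, Measurable fun σ : Fin r → Matrix.unitaryGroup (Fin n) ℂ =>
      f (unitaryAct n (σ a) z) := fun z =>
    measurable_infEDist_unitaryAct_inv (measurable_pi_apply a) measurable_const V c
  set c0 := ∫⁻ σ, f (unitaryAct n (σ a) (EuclideanSpace.single ⟨d a, hd⟩ 1)) ∂flagHaar n d with hc0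
  -- This reduces the sphere to the ball. A vector `z` of the ball is a flag vector, fixed by `σ`
  -- and contained in `V`, plus `τ ≤ 1` times a rotated copy of the coordinate vector. Right
  -- invariance absorbs the rotation, and the factor `τ` can only increase negative moments.
  have key : ∀ z : EuclideanSpace ℂ (Fin n), ‖z‖ ≤ 1 →
      c0 ≤ ∫⁻ σ, f (unitaryAct n (σ a) z) ∂flagHaar n d := by
    intro z hz
    obtain ⟨b, hb, z', hz', τ, hτ0, hτ1, rfl⟩ := exists_decomp_coordFlag hd z
    rw [hc0, ← hν.lintegral_mul_right (hfσ _) (mulSingle_mem_flagStabilizer hb)]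
    refine lintegral_mono_ae ?_
    filter_upwards [hν.ae_mem] with σ hσ
    simp only [Pi.mul_apply, Pi.mulSingle_eq_same, unitaryAct_mul, map_add, map_smul,
      unitaryAct_eq_self_of_mem_flagStabilizer hσ a hz', hf]
    have := infEDist_add_smul_le V (hdV hz')
      (x := unitaryAct n (σ a) (unitaryAct n b (EuclideanSpace.single ⟨d a, hd⟩ 1)))
      hτ0 (hτ1.trans hz)
    gcongr
  calc c0 = ∫⁻ _, c0 ∂unitBallMeasure n := by simp
    _ ≤ ∫⁻ z, ∫⁻ σ, f (unitaryAct n (σ a) z) ∂flagHaar n d ∂unitBallMeasure n := by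
        refine lintegral_mono_ae ?_
        filter_upwards [ae_unitBallMeasure_norm_le n] with z hz using key z hz
    _ = ∫⁻ σ, ∫⁻ z, f (unitaryAct n (σ a) z) ∂unitBallMeasure n ∂flagHaar n d := by
        refine lintegral_lintegral_swap (Measurable.aemeasurable ?_)
        exact measurable_infEDist_unitaryAct_inv ((measurable_pi_apply a).comp measurable_snd)
          measurable_fst V c
    _ = ∫⁻ z, f z ∂unitBallMeasure n := by
        simp_rw [lintegral_unitBallMeasure_unitaryAct _ hfm]
        simp
    _ ≤ 8 ^ n := lintegral_infEDist_inv_unitBallMeasure_le V hV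

/-! ### Conditioned Haar measures and the revealing of one image -/

/-- `μ` is the law of a Haar-random tuple of unitary matrices conditioned to have prescribed
restrictions to the subspaces `D a`, with images `R a`. -/
def IsConditionedHaar {n r : ℕ} (μ : Measure (Fin r → Matrix.unitaryGroup (Fin n) ℂ))
    (D R : Fin r → Submodule ℂ (EuclideanSpace ℂ (Fin n))) : Prop :=
  ∃ (d : Fin r → ℕ) (A B : Fin r → Matrix.unitaryGroup (Fin n) ℂ),
    μ = (flagHaar n d).map (fun k => A * k * B) ∧
    (∀ a, D a = (coordFlag n (d a)).map ((unitaryAct n (B a)⁻¹).toLinearEquiv : _ →ₗ[ℂ] _)) ∧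
    (∀ a, R a = (coordFlag n (d a)).map ((unitaryAct n (A a)).toLinearEquiv : _ →ₗ[ℂ] _))

namespace IsConditionedHaar

variable {n r : ℕ} {μ : Measure (Fin r → Matrix.unitaryGroup (Fin n) ℂ)}
  {D R : Fin r → Submodule ℂ (EuclideanSpace ℂ (Fin n))}

theorem isProbabilityMeasure (h : IsConditionedHaar μ D R) : IsProbabilityMeasure μ := by
  obtain ⟨d, A, B, rfl, -, -⟩ := h
  exact Measure.isProbabilityMeasure_map (by fun_prop)

theorem flagHaar_zero : IsConditionedHaar (flagHaar n (0 : Fin r → ℕ)) (fun _ => ⊥) fun _ => ⊥ := by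
  have h0 : coordFlag n 0 = ⊥ := by
    refine eq_bot_iff.2 fun z hz => ?_
    rw [Submodule.mem_bot]
    ext i
    exact hz i (Nat.zero_le _)
  refine ⟨0, 1, 1, by simp, fun a => ?_, fun a => ?_⟩ <;> simp [h0]

theorem inv (h : IsConditionedHaar μ D R) : IsConditionedHaar (μ.map fun g => g⁻¹) R D := by
  obtain ⟨d, A, B, rfl, hD, hR⟩ := h
  refine ⟨d, B⁻¹, A⁻¹, ?_, fun a => by simp [hR], fun a => by simp [hD]⟩
  rw [Measure.map_map (by fun_prop) (by fun_prop)]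
  refine Measure.ext_of_lintegral _ fun f hf => ?_
  rw [lintegral_map hf (by fun_prop), lintegral_map hf (by fun_prop)]
  rw [← (isSubgroupHaar_flagHaar n d).lintegral_inv]
  · simp [mul_assoc]
  · exact hf.comp (by fun_prop)

/-- Reveal the image of the vector `u` under the `a`-th matrix. -/
theorem lintegral_le (h : IsConditionedHaar μ D R) (a : Fin r) (u : EuclideanSpace ℂ (Fin n))
    {V₀ V : Submodule ℂ (EuclideanSpace ℂ (Fin n))} (hD : D a ≤ V₀) (hR : R a ≤ V) {c : ℕ}
    (hV : Module.finrank ℂ V + c + 1 ≤ n)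
    {F : (Fin r → Matrix.unitaryGroup (Fin n) ℂ) → ENNReal} (hF : Measurable F) {C : ENNReal}
    (hstep : ∀ (μ' : Measure (Fin r → Matrix.unitaryGroup (Fin n) ℂ))
      (D' R' : Fin r → Submodule ℂ (EuclideanSpace ℂ (Fin n))) (u' : EuclideanSpace ℂ (Fin n)),
      IsConditionedHaar μ' D' R' → D' a ≤ D a ⊔ ℂ ∙ u → R' a ≤ R a ⊔ ℂ ∙ u' →
      (∀ b, b ≠ a → D' b ≤ D b ∧ R' b ≤ R b) → (∀ᵐ g ∂μ', unitaryAct n (g a) u = u') →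
      ∫⁻ g, F g ∂μ' ≤ (Metric.infEDist u' V ^ (2 * c))⁻¹ * C) :
    ∫⁻ g, F g ∂μ ≤ 8 ^ n * (Metric.infEDist u V₀ ^ (2 * c))⁻¹ * C := by
  obtain ⟨d, A, B, rfl, hD', hR'⟩ := h
  have hν := isSubgroupHaar_flagHaar n d
  have hAV : ∀ z ∈ coordFlag n (d a), unitaryAct n (A a) z ∈ V := fun z hz =>
    hR (by rw [hR']; exact Submodule.mem_map_of_mem hz)
  have hd : d a < n := by
    by_contra hcon
    have htop : V = ⊤ := by
      refine eq_top_iff.2 fun y _ => ?_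
      rw [← unitaryAct_self_inv (A a) y]
      exact hAV _ (by rw [coordFlag_eq_top (not_lt.1 hcon)]; trivial)
    rw [htop, finrank_top] at hV
    simp at hV
  obtain ⟨b, hb, z', hz', τ, hτ0, -, hz⟩ := exists_decomp_coordFlag hd (unitaryAct n (B a) u)
  have hae : ∀ (d₁ : Fin r → ℕ) (A₁ B₁ : Fin r → Matrix.unitaryGroup (Fin n) ℂ),
      unitaryAct n (B₁ a) u ∈ coordFlag n (d₁ a) →
      ∀ᵐ g ∂(flagHaar n d₁).map (fun k => A₁ * k * B₁),
        unitaryAct n (g a) u = unitaryAct n (A₁ a) (unitaryAct n (B₁ a) u) := by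
    intro d₁ A₁ B₁ hmem
    have hms : MeasurableSet {g : Fin r → Matrix.unitaryGroup (Fin n) ℂ |
        unitaryAct n (g a) u = unitaryAct n (A₁ a) (unitaryAct n (B₁ a) u)} :=
      (isClosed_eq (by fun_prop) continuous_const).measurableSet
    refine (ae_map_iff (by fun_prop) hms).2 ?_
    filter_upwards [(isSubgroupHaar_flagHaar n d₁).ae_mem] with k hk
    rw [Pi.mul_apply, Pi.mul_apply, unitaryAct_mul, unitaryAct_mul,
      unitaryAct_eq_self_of_mem_flagStabilizer hk a hmem]
  -- `τ` is the length of the part of `u` orthogonal to the known domain. If it vanishes, the image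
  -- is already determined and lies in `V`, so both distances are zero and the bound holds because
  -- `8^n ≥ 1`.
  rcases hτ0.eq_or_lt with rfl | hτpos
  · have hz0 : unitaryAct n (B a) u = z' := by simpa using hz
    have huV₀ : u ∈ V₀ := by
      refine hD ?_
      rw [hD', ← unitaryAct_inv_self (B a) u, hz0]
      exact Submodule.mem_map_of_mem hz'
    have h1 := hstep _ D R (unitaryAct n (A a) (unitaryAct n (B a) u)) ⟨d, A, B, rfl, hD', hR'⟩
      le_sup_left le_sup_left (fun _ _ => ⟨le_rfl, le_rfl⟩) (hae d A B (hz0 ▸ hz'))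
    rw [Metric.infEDist_zero_of_mem (hz0 ▸ hAV z' hz')] at h1
    rw [Metric.infEDist_zero_of_mem huV₀, mul_assoc]
    exact h1.trans (le_mul_of_one_le_left' (one_le_pow₀ (by norm_num)))
  set d' : Fin r → ℕ := Function.update d a (d a + 1) with hd'
  have hdd' : d ≤ d' := by
    intro x
    by_cases hx : x = a
    · subst hx; simp [hd']
    · simp [hd', hx]
  have hbmem : Pi.mulSingle a b ∈ flagStabilizer n d := mulSingle_mem_flagStabilizer hb
  -- The rotation `b` lies in the stabilizer, so right invariance allows `B` to be replaced by `B'`;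
  -- now `u` is carried to `z' + τ e`, inside the next flag.
  set B' := (Pi.mulSingle a b)⁻¹ * B with hB'
  have hbz : unitaryAct n b⁻¹ z' = z' := by
    have := unitaryAct_eq_self_of_mem_flagStabilizer (inv_mem hbmem) a hz'
    simpa using this
  have hBu : unitaryAct n (B' a) u = z' + (τ : ℂ) • EuclideanSpace.single ⟨d a, hd⟩ 1 := by
    simp only [hB', Pi.mul_apply, Pi.inv_apply, Pi.mulSingle_eq_same]
    rw [unitaryAct_mul, hz, map_add, map_smul, unitaryAct_inv_self, hbz]
  set V' : Submodule ℂ (EuclideanSpace ℂ (Fin n)) :=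
    V.map ((unitaryAct n (A a)⁻¹).toLinearEquiv : _ →ₗ[ℂ] _) with hV'
  have hV'fin : Module.finrank ℂ V' + c + 1 ≤ n := by
    rw [hV', LinearEquiv.finrank_map_eq]; exact hV
  have hdV' : coordFlag n (d a) ≤ V' := fun z hz =>
    ⟨unitaryAct n (A a) z, hAV z hz, unitaryAct_inv_self _ _⟩
  have hV'V : ∀ z, Metric.infEDist z V' ≤ Metric.infEDist (unitaryAct n (A a) z) V := by
    intro z
    refine Metric.le_infEDist.2 fun y hy => ?_
    rw [← (unitaryAct n (A a)⁻¹).edist_map, unitaryAct_inv_self]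
    exact Metric.infEDist_le_edist_of_mem (Submodule.mem_map_of_mem hy)
  have hτu : Metric.infEDist u V₀ ≤ ENNReal.ofReal τ := by
    have hmem : unitaryAct n (B a)⁻¹ z' ∈ V₀ :=
      hD (by rw [hD']; exact Submodule.mem_map_of_mem hz')
    refine (Metric.infEDist_le_edist_of_mem hmem).trans ?_
    rw [← (unitaryAct n (B a)).edist_map, unitaryAct_self_inv, hz, edist_dist]
    refine ENNReal.ofReal_le_ofReal ?_
    rw [dist_eq_norm, add_sub_cancel_left, norm_smul, LinearIsometryEquiv.norm_map]
    simp [abs_of_nonneg hτ0]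
  set e : EuclideanSpace ℂ (Fin n) := EuclideanSpace.single ⟨d a, hd⟩ 1
  have hτc : (τ : ℂ) ≠ 0 := by exact_mod_cast hτpos.ne'
  have hstep' : ∀ σ ∈ flagStabilizer n d,
      ∫⁻ k, F (A * (σ * k) * B') ∂flagHaar n d' ≤
        (Metric.infEDist (unitaryAct n (σ a) e) V' ^ (2 * c))⁻¹ *
          ((Metric.infEDist u V₀ ^ (2 * c))⁻¹ * C) := by
    intro σ hσ
    set u' := unitaryAct n (A a) (unitaryAct n (σ a) (unitaryAct n (B' a) u)) with hu'
    have h1 := hstep ((flagHaar n d').map fun k => (A * σ) * k * B')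
      (fun x => (coordFlag n (d' x)).map ((unitaryAct n (B' x)⁻¹).toLinearEquiv : _ →ₗ[ℂ] _))
      (fun x => (coordFlag n (d' x)).map
        ((unitaryAct n ((A * σ) x)).toLinearEquiv : _ →ₗ[ℂ] _)) u'
      ⟨d', A * σ, B', rfl, fun _ => rfl, fun _ => rfl⟩ ?_ ?_ ?_ ?_
    · rw [lintegral_map hF (by fun_prop)] at h1
      simp_rw [← mul_assoc A σ]
      refine h1.trans ?_
      rw [← mul_assoc]
      gcongr ?_ * C
      have h2 : ENNReal.ofReal τ * Metric.infEDist (unitaryAct n (σ a) e) V' ≤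
          Metric.infEDist u' V := by
        refine le_trans ?_ (hV'V _)
        rw [hBu, map_add, map_smul, unitaryAct_eq_self_of_mem_flagStabilizer hσ a hz']
        exact mul_infEDist_le_infEDist_add_smul V' (hdV' hz') hτ0
      -- This is the multiplicativity of distances: `u'` has a known part in `V` and a fresh part of
      -- length `τ ≥ dist(u, V₀)`.
      have h3 : Metric.infEDist (unitaryAct n (σ a) e) V' * Metric.infEDist u V₀ ≤
          Metric.infEDist u' V := by
        refine le_trans ?_ h2
        rw [mul_comm]
        gcongr
      have hfin : ∀ (W : Submodule ℂ (EuclideanSpace ℂ (Fin n))) z,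
          Metric.infEDist z (W : Set (EuclideanSpace ℂ (Fin n))) ^ (2 * c) ≠ ⊤ := fun W z =>
        ENNReal.pow_ne_top (Metric.infEDist_ne_top ⟨0, W.zero_mem⟩)
      rw [← ENNReal.mul_inv (Or.inr (hfin _ _)) (Or.inl (hfin _ _)), ← mul_pow]
      gcongr
    · rw [Submodule.map_le_iff_le_comap]
      simp only [hd', Function.update_self]
      have hDa : ∀ z ∈ coordFlag n (d a), unitaryAct n (B' a)⁻¹ z ∈ D a := by
        intro z hz
        rw [hD']
        refine ⟨z, hz, ?_⟩
        have : unitaryAct n b z = z := by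
          simpa using unitaryAct_eq_self_of_mem_flagStabilizer hbmem a hz
        simp only [hB', Pi.mul_apply, Pi.inv_apply, Pi.mulSingle_eq_same, mul_inv_rev, inv_inv]
        rw [unitaryAct_mul, this]
        rfl
      refine coordFlag_succ_le hd _ (fun z hz => Submodule.mem_sup_left (hDa z hz)) ?_
      have h2 : u = unitaryAct n (B' a)⁻¹ z' + (τ : ℂ) • unitaryAct n (B' a)⁻¹ e := by
        rw [← map_smul, ← map_add, ← hBu, unitaryAct_inv_self]
      have h3 : unitaryAct n (B' a)⁻¹ e = (τ : ℂ)⁻¹ • (u - unitaryAct n (B' a)⁻¹ z') := by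
        conv_rhs => rw [h2]
        rw [add_sub_cancel_left, smul_smul, inv_mul_cancel₀ hτc, one_smul]
      rw [Submodule.mem_comap]
      change unitaryAct n (B' a)⁻¹ e ∈ _
      rw [h3]
      exact Submodule.smul_mem _ _ (Submodule.sub_mem _
        (Submodule.mem_sup_right (Submodule.mem_span_singleton_self u))
        (Submodule.mem_sup_left (hDa z' hz')))
    · rw [Submodule.map_le_iff_le_comap]
      simp only [hd', Function.update_self]
      have hRa : ∀ z ∈ coordFlag n (d a), unitaryAct n ((A * σ) a) z ∈ R a := by
        intro z hz
        rw [hR', Pi.mul_apply, unitaryAct_mul, unitaryAct_eq_self_of_mem_flagStabilizer hσ a hz]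
        exact Submodule.mem_map_of_mem hz
      refine coordFlag_succ_le hd _ (fun z hz => Submodule.mem_sup_left (hRa z hz)) ?_
      have h2 : u' = unitaryAct n ((A * σ) a) z' + (τ : ℂ) • unitaryAct n ((A * σ) a) e := by
        rw [← map_smul, ← map_add, ← hBu, hu', Pi.mul_apply, unitaryAct_mul]
      have h3 : unitaryAct n ((A * σ) a) e =
          (τ : ℂ)⁻¹ • (u' - unitaryAct n ((A * σ) a) z') := by
        conv_rhs => rw [h2]
        rw [add_sub_cancel_left, smul_smul, inv_mul_cancel₀ hτc, one_smul]
      rw [Submodule.mem_comap]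
      change unitaryAct n ((A * σ) a) e ∈ _
      rw [h3]
      exact Submodule.smul_mem _ _ (Submodule.sub_mem _
        (Submodule.mem_sup_right (Submodule.mem_span_singleton_self u'))
        (Submodule.mem_sup_left (hRa z' hz')))
    · intro x hx
      simp only [hd', Function.update_of_ne hx]
      refine ⟨le_of_eq ?_, le_of_eq ?_⟩
      · rw [hD']; simp [hB', hx]
      · rw [hR', Pi.mul_apply]
        ext y
        simp only [Submodule.mem_map]
        refine exists_congr fun z => and_congr_right fun hz => ?_
        change unitaryAct n (A x * σ x) z = y ↔ unitaryAct n (A x) z = y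
        rw [unitaryAct_mul, unitaryAct_eq_self_of_mem_flagStabilizer hσ x hz]
    · have h2 := hae d' (A * σ) B' (by
        rw [hBu]
        refine add_mem (coordFlag_mono (hdd' a) hz') (Submodule.smul_mem _ _ ?_)
        exact single_mem_coordFlag (by simp [hd']) 1)
      simpa only [Pi.mul_apply, unitaryAct_mul] using h2
  calc ∫⁻ g, F g ∂(flagHaar n d).map (fun k => A * k * B)
      = ∫⁻ k, F (A * k * B) ∂flagHaar n d := lintegral_map hF (by fun_prop)
    _ = ∫⁻ k, F (A * k * B') ∂flagHaar n d := by
        rw [← hν.lintegral_mul_right (f := fun k => F (A * k * B)) (hF.comp (by fun_prop))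
          (inv_mem hbmem)]
        simp [hB', mul_assoc]
    _ = ∫⁻ σ, ∫⁻ k, F (A * (σ * k) * B') ∂flagHaar n d' ∂flagHaar n d :=
        hν.lintegral_conv (isSubgroupHaar_flagHaar n d') (flagStabilizer_anti hdd')
          (f := fun k => F (A * k * B')) (hF.comp (by fun_prop))
    _ ≤ ∫⁻ σ, (Metric.infEDist (unitaryAct n (σ a) e) V' ^ (2 * c))⁻¹ *
          ((Metric.infEDist u V₀ ^ (2 * c))⁻¹ * C) ∂flagHaar n d := by
        refine lintegral_mono_ae ?_
        filter_upwards [hν.ae_mem] with σ hσ using hstep' σ hσ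
    _ = (∫⁻ σ, (Metric.infEDist (unitaryAct n (σ a) e) V' ^ (2 * c))⁻¹ ∂flagHaar n d) *
          ((Metric.infEDist u V₀ ^ (2 * c))⁻¹ * C) :=
        lintegral_mul_const _ (measurable_infEDist_unitaryAct_inv (measurable_pi_apply a)
          measurable_const V' c)
    _ ≤ 8 ^ n * ((Metric.infEDist u V₀ ^ (2 * c))⁻¹ * C) := by
        gcongr
        exact lintegral_infEDist_inv_flagHaar_le hd V' hdV' hV'fin
    _ = _ := by rw [mul_assoc]

end IsConditionedHaar

/-! ### Trajectories of vectors under a word -/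

/-- A family of subspaces spanned by finitely many measurable families of vectors. -/
def IsMeasurableSpan {n : ℕ} {X : Type} [MeasurableSpace X]
    (V : X → Submodule ℂ (EuclideanSpace ℂ (Fin n))) : Prop :=
  ∃ (N : ℕ) (b : Fin N → X → EuclideanSpace ℂ (Fin n)), (∀ i, Measurable (b i)) ∧
    ∀ x, V x = Submodule.span ℂ (Set.range fun i => b i x)

namespace IsMeasurableSpan

variable {n : ℕ} {X Y : Type} [MeasurableSpace X] [MeasurableSpace Y]
  {V : X → Submodule ℂ (EuclideanSpace ℂ (Fin n))}

theorem const (W : Submodule ℂ (EuclideanSpace ℂ (Fin n))) :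
    IsMeasurableSpan fun _ : X => W := by
  obtain ⟨N, b, hb⟩ := Submodule.fg_iff_exists_fin_generating_family.1
    (IsNoetherian.noetherian W)
  exact ⟨N, fun i _ => b i, fun _ => measurable_const, fun _ => hb.symm⟩

theorem comp (hV : IsMeasurableSpan V) {f : Y → X} (hf : Measurable f) :
    IsMeasurableSpan fun y => V (f y) := by
  obtain ⟨N, b, hb, h⟩ := hV
  exact ⟨N, fun i y => b i (f y), fun i => (hb i).comp hf, fun y => h (f y)⟩

theorem sup_span_singleton (hV : IsMeasurableSpan V) {u : X → EuclideanSpace ℂ (Fin n)}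
    (hu : Measurable u) : IsMeasurableSpan fun x => V x ⊔ ℂ ∙ u x := by
  obtain ⟨N, b, hb, h⟩ := hV
  refine ⟨N + 1, Fin.cons u b, fun i => ?_, fun x => ?_⟩
  · refine Fin.cases ?_ (fun i => ?_) i
    · simpa using hu
    · simpa using hb i
  · have : (fun i => (Fin.cons u b : Fin (N + 1) → X → EuclideanSpace ℂ (Fin n)) i x) =
        Fin.cons (u x) fun i => b i x := by
      funext i
      refine Fin.cases ?_ (fun i => ?_) i <;> simp
    rw [this, Fin.range_cons, Submodule.span_insert, ← h x]
    exact sup_comm _ _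

/-- The distance is an infimum over coefficients of functions continuous in the point and the
spanning vectors. Though uncountable, such an infimum is upper semicontinuous, hence Borel, even
where the dimension of the span jumps. -/
theorem measurable_infEDist (hV : IsMeasurableSpan V) {u : X → EuclideanSpace ℂ (Fin n)}
    (hu : Measurable u) : Measurable fun x => Metric.infEDist (u x) (V x) := by
  obtain ⟨N, b, hb, h⟩ := hV
  have hcont : ∀ c : Fin N → ℂ, Continuous fun p : EuclideanSpace ℂ (Fin n) ×
      (Fin N → EuclideanSpace ℂ (Fin n)) => edist p.1 (∑ i, c i • p.2 i) := fun c => by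
    fun_prop
  obtain ⟨Φ, hΦ⟩ : ∃ Φ : EuclideanSpace ℂ (Fin n) × (Fin N → EuclideanSpace ℂ (Fin n)) → ENNReal,
      Φ = fun p => ⨅ c : Fin N → ℂ, edist p.1 (∑ i, c i • p.2 i) := ⟨_, rfl⟩
  have hΦm : Measurable Φ := by
    rw [hΦ]
    exact (upperSemicontinuous_iInf fun c => (hcont c).upperSemicontinuous).measurable
  have heq : ∀ x, Metric.infEDist (u x) (V x) =
      Φ (u x, fun i => b i x) := by
    intro x
    rw [hΦ]
    refine le_antisymm (le_iInf fun c => Metric.infEDist_le_edist_of_mem ?_)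
      (Metric.le_infEDist.2 fun y hy => ?_)
    · rw [h x]
      exact Submodule.sum_mem _ fun i _ =>
        Submodule.smul_mem _ _ (Submodule.subset_span ⟨i, rfl⟩)
    · rw [h x] at hy
      obtain ⟨c, rfl⟩ := (Submodule.mem_span_range_iff_exists_fun ℂ).1 hy
      exact iInf_le _ c
  have hm : Measurable fun x => (u x, fun i => b i x) := hu.prodMk (measurable_pi_lambda _ hb)
  rw [funext heq]
  exact hΦm.comp hm

end IsMeasurableSpan

/-- The unitary matrix substituted for a letter of a word. -/
def letterValue {n r : ℕ} (g : Fin r → Matrix.unitaryGroup (Fin n) ℂ) (y : Fin r × Bool) :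
    Matrix.unitaryGroup (Fin n) ℂ :=
  bif y.2 then g y.1 else (g y.1)⁻¹

theorem measurable_letterValue {n r : ℕ} (y : Fin r × Bool) :
    Measurable fun g : Fin r → Matrix.unitaryGroup (Fin n) ℂ => letterValue g y := by
  unfold letterValue
  cases y.2
  · exact (measurable_pi_apply y.1).inv
  · exact measurable_pi_apply y.1

/-- The end point of the trajectory of `u` under the letters of `w`, the first letter
acting first. -/
noncomputable def walkEnd {n r : ℕ} (g : Fin r → Matrix.unitaryGroup (Fin n) ℂ) :
    EuclideanSpace ℂ (Fin n) → List (Fin r × Bool) → EuclideanSpace ℂ (Fin n)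
  | u, [] => u
  | u, y :: w => walkEnd g (unitaryAct n (letterValue g y) u) w

theorem walkEnd_eq {n r : ℕ} (g : Fin r → Matrix.unitaryGroup (Fin n) ℂ)
    (w : List (Fin r × Bool)) (u : EuclideanSpace ℂ (Fin n)) :
    walkEnd g u w = unitaryAct n (w.reverse.map (letterValue g)).prod u := by
  induction w generalizing u with
  | nil => simp [walkEnd]
  | cons y w ih =>
    rw [walkEnd, ih, ← unitaryAct_mul]
    simp

/-- The negative power of the distance from the end of the trajectory of `u` to the span of `V`
and the previous points of the trajectory, weighted with a function `K` of the span of `V` and all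
points of the trajectory. -/
noncomputable def walkWeight {n r : ℕ} (g : Fin r → Matrix.unitaryGroup (Fin n) ℂ) (c : ℕ)
    (K : Submodule ℂ (EuclideanSpace ℂ (Fin n)) → ENNReal) :
    Submodule ℂ (EuclideanSpace ℂ (Fin n)) → EuclideanSpace ℂ (Fin n) →
      List (Fin r × Bool) → ENNReal
  | V, u, [] => (Metric.infEDist u V ^ (2 * c))⁻¹ * K (V ⊔ ℂ ∙ u)
  | V, u, y :: w => walkWeight g c K (V ⊔ ℂ ∙ u) (unitaryAct n (letterValue g y) u) w

/-- The average, over independent starting vectors in the unit ball, of the product of the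
weights of the successive trajectories. -/
noncomputable def totalWeight {n r : ℕ} (g : Fin r → Matrix.unitaryGroup (Fin n) ℂ)
    (w : List (Fin r × Bool)) : List ℕ → Submodule ℂ (EuclideanSpace ℂ (Fin n)) → ENNReal
  | [], _ => 1
  | c :: cs, V => ∫⁻ v, walkWeight g c (totalWeight g w cs) V v w ∂unitBallMeasure n

theorem measurable_walkWeight {n r : ℕ} {X : Type} [MeasurableSpace X]
    {g : X → Fin r → Matrix.unitaryGroup (Fin n) ℂ} (hg : Measurable g) (c : ℕ)
    {K : X → Submodule ℂ (EuclideanSpace ℂ (Fin n)) → ENNReal}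
    (hK : ∀ V : X → Submodule ℂ (EuclideanSpace ℂ (Fin n)), IsMeasurableSpan V →
      Measurable fun x => K x (V x))
    (w : List (Fin r × Bool)) {V : X → Submodule ℂ (EuclideanSpace ℂ (Fin n))}
    (hV : IsMeasurableSpan V) {u : X → EuclideanSpace ℂ (Fin n)} (hu : Measurable u) :
    Measurable fun x => walkWeight (g x) c (K x) (V x) (u x) w := by
  induction w generalizing V u with
  | nil =>
    simp only [walkWeight]
    exact ((hV.measurable_infEDist hu).pow_const _).inv.mul (hK _ (hV.sup_span_singleton hu))
  | cons y w ih =>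
    simp only [walkWeight]
    exact ih (hV.sup_span_singleton hu)
      (((measurable_letterValue y).comp hg).unitaryAct_apply hu)

theorem measurable_totalWeight {n r : ℕ} (w : List (Fin r × Bool)) (cs : List ℕ)
    {X : Type} [MeasurableSpace X]
    {g : X → Fin r → Matrix.unitaryGroup (Fin n) ℂ} (hg : Measurable g)
    {V : X → Submodule ℂ (EuclideanSpace ℂ (Fin n))} (hV : IsMeasurableSpan V) :
    Measurable fun x => totalWeight (g x) w cs (V x) := by
  induction cs generalizing X with
  | nil => simp only [totalWeight]; exact measurable_const
  | cons c cs ih =>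
    simp only [totalWeight]
    have h : Measurable fun p : X × EuclideanSpace ℂ (Fin n) =>
        walkWeight (g p.1) c (totalWeight (g p.1) w cs) (V p.1) p.2 w :=
      measurable_walkWeight (hg.comp measurable_fst) c
        (fun _ hW => ih (hg.comp measurable_fst) hW) w (hV.comp measurable_fst) measurable_snd
    exact h.lintegral_prod_right'

/-- The span only grows along the walk, so `p` still belongs to it at the end and bounds the
distance from above. -/
theorem le_walkWeight {n r : ℕ} (g : Fin r → Matrix.unitaryGroup (Fin n) ℂ) (c : ℕ)
    {K : Submodule ℂ (EuclideanSpace ℂ (Fin n)) → ENNReal} {C : ENNReal} (hK : ∀ V, C ≤ K V)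
    (w : List (Fin r × Bool)) {V : Submodule ℂ (EuclideanSpace ℂ (Fin n))}
    (u : EuclideanSpace ℂ (Fin n)) {p : EuclideanSpace ℂ (Fin n)} (hp : p ∈ V) :
    (edist (walkEnd g u w) p ^ (2 * c))⁻¹ * C ≤ walkWeight g c K V u w := by
  induction w generalizing V u with
  | nil =>
    simp only [walkWeight, walkEnd]
    have h := Metric.infEDist_le_edist_of_mem (x := u) (s := (V : Set _)) hp
    gcongr
    exact hK _
  | cons y w ih => exact ih _ (Submodule.mem_sup_left hp)

/-- Lower bound for the total weight when `w(g)` has many eigenvalues close to `lam`. -/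
theorem le_totalWeight {n r : ℕ} (g : Fin r → Matrix.unitaryGroup (Fin n) ℂ)
    {w : List (Fin r × Bool)} (hw : w ≠ []) (lam : ℂ) {M : Matrix (Fin n) (Fin n) ℂ}
    (hM : ∀ v, Matrix.toEuclideanLin M v = walkEnd g v w - lam • v)
    (hdet : M.det ≠ 0) {ε : ℝ} (hε : 0 < ε)
    (hMε : ∀ v, ε * ‖v‖ ≤ ‖Matrix.toEuclideanLin M v‖)
    (cs : List ℕ) (V : Submodule ℂ (EuclideanSpace ℂ (Fin n))) :
    (cs.map fun c => ENNReal.ofReal (ε ^ (2 * n) * (ε ^ (2 * c))⁻¹ * (‖M.det‖ ^ 2)⁻¹)).prod ≤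
      totalWeight g w cs V := by
  induction cs generalizing V with
  | nil => simp [totalWeight]
  | cons c cs ih =>
    rw [List.map_cons, List.prod_cons, totalWeight]
    refine (mul_le_mul_left (le_lintegral_enorm_inv_unitBallMeasure hdet hε hMε c) _).trans ?_
    rw [← lintegral_mul_const']
    · refine lintegral_mono fun v => ?_
      -- Since the word is nonempty, `v` joins the span before the end point is measured, so `lam •
      -- v` is an admissible comparison point.
      obtain ⟨y, w', rfl⟩ := List.exists_cons_of_ne_nil hw
      have h := le_walkWeight g c ih w' (V := V ⊔ ℂ ∙ v) (unitaryAct n (letterValue g y) v)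
        (p := lam • v) (Submodule.mem_sup_right
          (Submodule.smul_mem _ _ (Submodule.mem_span_singleton_self v)))
      rwa [edist_eq_enorm_sub, show walkEnd g (unitaryAct n (letterValue g y) v) w' - lam • v =
        Matrix.toEuclideanLin M v from (hM v).symm] at h
    · exact (List.prod_induction (· ≠ ⊤) (fun _ _ => ENNReal.mul_ne_top) ENNReal.one_ne_top
        (by simp))

theorem finrank_sup_span_singleton_le {n : ℕ} (V : Submodule ℂ (EuclideanSpace ℂ (Fin n)))
    (u : EuclideanSpace ℂ (Fin n)) :
    Module.finrank ℂ ↥(V ⊔ ℂ ∙ u) ≤ Module.finrank ℂ V + 1 := by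
  have h1 := Submodule.finrank_add_le_finrank_add_finrank V (ℂ ∙ u)
  have h2 : Module.finrank ℂ ↥(ℂ ∙ u) ≤ 1 := by
    simpa using finrank_span_le_card (R := ℂ) ({u} : Set (EuclideanSpace ℂ (Fin n)))
  omega

/-! ### Upper bounds for the expected weights -/

/-- Reveal the image of the vector `u` under a letter. -/
theorem IsConditionedHaar.lintegral_letter_le {n r : ℕ}
    {μ : Measure (Fin r → Matrix.unitaryGroup (Fin n) ℂ)}
    {D R : Fin r → Submodule ℂ (EuclideanSpace ℂ (Fin n))}
    (h : IsConditionedHaar μ D R) (y : Fin r × Bool) (u : EuclideanSpace ℂ (Fin n))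
    {V₀ V : Submodule ℂ (EuclideanSpace ℂ (Fin n))}
    (hD : (bif y.2 then D y.1 else R y.1) ≤ V₀) (hR : (bif y.2 then R y.1 else D y.1) ≤ V) {c : ℕ}
    (hV : Module.finrank ℂ V + c + 1 ≤ n)
    {F : (Fin r → Matrix.unitaryGroup (Fin n) ℂ) → ENNReal} (hF : Measurable F) {C : ENNReal}
    (hstep : ∀ (μ' : Measure (Fin r → Matrix.unitaryGroup (Fin n) ℂ))
      (D' R' : Fin r → Submodule ℂ (EuclideanSpace ℂ (Fin n))) (u' : EuclideanSpace ℂ (Fin n)),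
      IsConditionedHaar μ' D' R' →
      (bif y.2 then D' y.1 else R' y.1) ≤ (bif y.2 then D y.1 else R y.1) ⊔ ℂ ∙ u →
      (bif y.2 then R' y.1 else D' y.1) ≤ (bif y.2 then R y.1 else D y.1) ⊔ ℂ ∙ u' →
      (∀ b, b ≠ y.1 → D' b ≤ D b ∧ R' b ≤ R b) →
      (∀ᵐ g ∂μ', unitaryAct n (letterValue g y) u = u') →
      ∫⁻ g, F g ∂μ' ≤ (Metric.infEDist u' V ^ (2 * c))⁻¹ * C) :
    ∫⁻ g, F g ∂μ ≤ 8 ^ n * (Metric.infEDist u V₀ ^ (2 * c))⁻¹ * C := by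
  obtain ⟨a, s⟩ := y
  cases s
  · simp only [cond_false, letterValue] at hD hR hstep
    have hinv : ∀ μ₁ : Measure (Fin r → Matrix.unitaryGroup (Fin n) ℂ),
        ∫⁻ g, F g⁻¹ ∂(μ₁.map fun g => g⁻¹) = ∫⁻ g, F g ∂μ₁ := by
      intro μ₁
      rw [lintegral_map (f := fun g => F g⁻¹) (hF.comp measurable_inv) measurable_inv]
      simp
    rw [← hinv]
    refine h.inv.lintegral_le a u hD hR hV (hF.comp measurable_inv)
      fun μ' D' R' u' h' h1 h2 h3 h4 => ?_
    have h5 := hstep _ R' D' u' h'.inv h1 h2 (fun b hb => (h3 b hb).symm) ?_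
    · rwa [lintegral_map hF measurable_inv] at h5
    · have hms : MeasurableSet {g : Fin r → Matrix.unitaryGroup (Fin n) ℂ |
          unitaryAct n (g a)⁻¹ u = u'} :=
        (isClosed_eq (by fun_prop) continuous_const).measurableSet
      refine (ae_map_iff measurable_inv.aemeasurable hms).2 ?_
      simpa using h4
  · exact h.lintegral_le a u hD hR hV hF hstep

/-- Upper bound for the expected weight of a single trajectory. -/
theorem IsConditionedHaar.lintegral_walkWeight_le {n r N c : ℕ}
    {K : (Fin r → Matrix.unitaryGroup (Fin n) ℂ) →
      Submodule ℂ (EuclideanSpace ℂ (Fin n)) → ENNReal}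
    (hKm : ∀ V : (Fin r → Matrix.unitaryGroup (Fin n) ℂ) →
      Submodule ℂ (EuclideanSpace ℂ (Fin n)), IsMeasurableSpan V → Measurable fun g => K g (V g))
    {C : ENNReal}
    (hK : ∀ (μ : Measure (Fin r → Matrix.unitaryGroup (Fin n) ℂ))
      (D R : Fin r → Submodule ℂ (EuclideanSpace ℂ (Fin n)))
      (V : Submodule ℂ (EuclideanSpace ℂ (Fin n))), IsConditionedHaar μ D R →
      (∀ a, D a ≤ V ∧ R a ≤ V) → Module.finrank ℂ V ≤ N → ∫⁻ g, K g V ∂μ ≤ C)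
    (hN : N + c ≤ n) (w : List (Fin r × Bool)) (hw : FreeGroup.IsReduced w)
    {μ : Measure (Fin r → Matrix.unitaryGroup (Fin n) ℂ)}
    {D R : Fin r → Submodule ℂ (EuclideanSpace ℂ (Fin n))}
    {V : Submodule ℂ (EuclideanSpace ℂ (Fin n))} {u : EuclideanSpace ℂ (Fin n)}
    (h : IsConditionedHaar μ D R) (hDR : ∀ a, D a ≤ V ⊔ ℂ ∙ u ∧ R a ≤ V ⊔ ℂ ∙ u)
    (hhead : ∀ y ∈ w.head?, (bif y.2 then D y.1 else R y.1) ≤ V)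
    (hV : Module.finrank ℂ V + w.length + 1 ≤ N) :
    ∫⁻ g, walkWeight g c (K g) V u w ∂μ ≤
      (8 ^ n) ^ w.length * (Metric.infEDist u V ^ (2 * c))⁻¹ * C := by
  induction w generalizing μ D R V u with
  | nil =>
    simp only [walkWeight, List.length_nil, pow_zero, one_mul] at hV ⊢
    rw [lintegral_const_mul _ (hKm _ (IsMeasurableSpan.const _))]
    gcongr
    exact hK μ D R _ h hDR ((finrank_sup_span_singleton_le V u).trans hV)
  | cons y w ih =>
    have hfr := finrank_sup_span_singleton_le V u
    rw [List.length_cons] at hV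
    have hsource : (bif y.2 then D y.1 else R y.1) ≤ V := hhead y (by simp)
    have hmeas : Measurable fun g : Fin r → Matrix.unitaryGroup (Fin n) ℂ =>
        walkWeight g c (K g) V u (y :: w) :=
      measurable_walkWeight measurable_id c hKm _ (IsMeasurableSpan.const V) measurable_const
    -- The prescribed source of `y` avoids the current point and sits in `V`, while its target may
    -- contain `u`. The distance from `u` to `V` thus passes to that from `u'` to `V ⊔ ℂ ∙ u`.
    have key := h.lintegral_letter_le y u hsource
      (V := V ⊔ ℂ ∙ u) (by cases y.2; exacts [(hDR y.1).1, (hDR y.1).2]) (c := c) (by omega)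
      hmeas (C := (8 ^ n) ^ w.length * C) ?_
    · refine key.trans_eq ?_
      rw [List.length_cons, pow_succ]
      ring
    · intro μ' D' R' u' h' hs ht hrest hae
      have hcongr : ∫⁻ g, walkWeight g c (K g) V u (y :: w) ∂μ' =
          ∫⁻ g, walkWeight g c (K g) (V ⊔ ℂ ∙ u) u' w ∂μ' := by
        refine lintegral_congr_ae ?_
        filter_upwards [hae] with g hg
        rw [walkWeight, hg]
      have hs' : (bif y.2 then D' y.1 else R' y.1) ≤ V ⊔ ℂ ∙ u :=
        hs.trans (sup_le_sup_right hsource _)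
      have ht' : (bif y.2 then R' y.1 else D' y.1) ≤ V ⊔ ℂ ∙ u ⊔ ℂ ∙ u' := by
        refine ht.trans (sup_le_sup_right ?_ _)
        cases y.2
        exacts [(hDR y.1).1, (hDR y.1).2]
      rw [hcongr]
      refine (ih (List.IsChain.tail hw) h' (fun b => ?_) (fun z hz => ?_)
        (by omega)).trans_eq (by ring)
      · by_cases hb : b = y.1
        · subst hb
          revert hs' ht'
          cases y.2
          · exact fun hs' ht' => ⟨ht', hs'.trans le_sup_left⟩
          · exact fun hs' ht' => ⟨hs'.trans le_sup_left, ht'⟩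
        · exact ⟨((hrest b hb).1.trans (hDR b).1).trans le_sup_left,
            ((hrest b hb).2.trans (hDR b).2).trans le_sup_left⟩
      -- Reducedness enters here: if the next letter uses the same generator it has the same sign,
      -- so its source is that of `y`, which did not acquire `u'`.
      · by_cases hb : z.1 = y.1
        · have hyz : y.1 = z.1 → y.2 = z.2 := by
            obtain ⟨w', rfl⟩ : ∃ w', w = z :: w' := by
              cases w with
              | nil => simp at hz
              | cons z' w' => exact ⟨w', by simp at hz; rw [hz]⟩
            exact (List.isChain_cons_cons.1 hw).1
          rw [← hyz hb.symm, hb]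
          exact hs'
        · cases z.2
          exacts [(hrest _ hb).2.trans (hDR _).2, (hrest _ hb).1.trans (hDR _).1]

/-- The exponents `cs` of trajectories of `L` points, starting in dimension `N`, are small enough
for the corresponding negative moments to be finite. -/
def FitsDimension (n L : ℕ) : ℕ → List ℕ → Prop
  | _, [] => True
  | N, c :: cs => N + L + c ≤ n ∧ FitsDimension n L (N + L) cs

/-- Upper bound for the expected total weight. -/
theorem IsConditionedHaar.lintegral_totalWeight_le {n r N : ℕ} {w : List (Fin r × Bool)}
    (hw : FreeGroup.IsReduced w) (cs : List ℕ) (hcs : FitsDimension n (w.length + 1) N cs)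
    {μ : Measure (Fin r → Matrix.unitaryGroup (Fin n) ℂ)}
    {D R : Fin r → Submodule ℂ (EuclideanSpace ℂ (Fin n))}
    {V : Submodule ℂ (EuclideanSpace ℂ (Fin n))}
    (h : IsConditionedHaar μ D R) (hDR : ∀ a, D a ≤ V ∧ R a ≤ V) (hV : Module.finrank ℂ V ≤ N) :
    ∫⁻ g, totalWeight g w cs V ∂μ ≤ (8 ^ n) ^ ((w.length + 1) * cs.length) := by
  have := h.isProbabilityMeasure
  induction cs generalizing N μ D R V with
  | nil => simp [totalWeight]
  | cons c cs ih =>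
    obtain ⟨hc, hcs⟩ := hcs
    simp only [totalWeight]
    have hmeas : Measurable fun p : (Fin r → Matrix.unitaryGroup (Fin n) ℂ) ×
        EuclideanSpace ℂ (Fin n) => walkWeight p.1 c (totalWeight p.1 w cs) V p.2 w :=
      measurable_walkWeight measurable_fst c
        (fun _ hW => measurable_totalWeight w cs measurable_fst hW) w
        (IsMeasurableSpan.const V) measurable_snd
    rw [lintegral_lintegral_swap hmeas.aemeasurable]
    set C : ENNReal := (8 ^ n) ^ ((w.length + 1) * cs.length) with hC
    calc ∫⁻ v, ∫⁻ g, walkWeight g c (totalWeight g w cs) V v w ∂μ ∂unitBallMeasure n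
        ≤ ∫⁻ v, (8 ^ n) ^ w.length * (Metric.infEDist v V ^ (2 * c))⁻¹ * C
            ∂unitBallMeasure n := by
          refine lintegral_mono fun v => ?_
          refine h.lintegral_walkWeight_le (N := N + (w.length + 1))
            (fun _ hW => measurable_totalWeight w cs measurable_id hW)
            (fun μ' D' R' V' h' hDR' hV' => ?_) hc w hw
            (fun a => ⟨(hDR a).1.trans le_sup_left, (hDR a).2.trans le_sup_left⟩)
            (fun y _ => ?_) (by omega)
          · exact ih hcs h' hDR' hV' h'.isProbabilityMeasure
          · cases y.2
            exacts [(hDR _).2, (hDR _).1]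
      _ = (8 ^ n) ^ w.length * (∫⁻ v, (Metric.infEDist v V ^ (2 * c))⁻¹ ∂unitBallMeasure n) *
            C := by
          have hm : Measurable fun v : EuclideanSpace ℂ (Fin n) =>
              (Metric.infEDist v (V : Set (EuclideanSpace ℂ (Fin n))) ^ (2 * c))⁻¹ :=
            (Metric.continuous_infEDist.measurable.pow_const _).inv
          rw [lintegral_mul_const _ (hm.const_mul _), lintegral_const_mul _ hm]
      -- The random starting vector costs one more factor `8^n`, hence `w.length + 1` factors per
      -- trajectory.
      _ ≤ (8 ^ n) ^ w.length * 8 ^ n * C := by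
          gcongr
          exact lintegral_infEDist_inv_unitBallMeasure_le V (by omega)
      _ = _ := by
          rw [hC, ← pow_succ, ← pow_add, List.length_cons]
          congr 1
          ring

/-! ### Eigenvalues in an arc -/

theorem norm_eq_one_of_mem_roots_charpoly {n : ℕ} (g : Matrix.unitaryGroup (Fin n) ℂ) {z : ℂ}
    (hz : z ∈ (g : Matrix (Fin n) (Fin n) ℂ).charpoly.roots) : ‖z‖ = 1 := by
  have h0 : (Matrix.scalar (Fin n) z - (g : Matrix (Fin n) (Fin n) ℂ)).det = 0 := by
    rw [← Matrix.eval_charpoly]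
    exact (Polynomial.mem_roots'.1 hz).2
  obtain ⟨v, hv0, hv⟩ := Matrix.exists_mulVec_eq_zero_iff.2 h0
  have h1 : unitaryAct n g (WithLp.toLp 2 v) = z • WithLp.toLp 2 v := by
    rw [unitaryAct_apply]
    change WithLp.toLp 2 ((g : Matrix (Fin n) (Fin n) ℂ).mulVec v) = _
    rw [Matrix.sub_mulVec, sub_eq_zero] at hv
    rw [← hv, Matrix.scalar_apply]
    ext i
    simp [Matrix.mulVec_diagonal]
  have h2 : ‖WithLp.toLp 2 v‖ = ‖z‖ * ‖WithLp.toLp 2 v‖ := by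
    rw [← norm_smul, ← h1, LinearIsometryEquiv.norm_map]
  have h3 : ‖(WithLp.toLp 2 v : EuclideanSpace ℂ (Fin n))‖ ≠ 0 := by
    rw [norm_ne_zero_iff]
    intro h
    exact hv0 (by simpa using congrArg WithLp.ofLp h)
  field_simp at h2
  exact h2.symm

open Classical in
theorem prod_norm_sub_le {lam : ℂ} {A : Set ℂ} {ε : ℝ} (hε : 0 ≤ ε) (s : Multiset ℂ)
    (hs : ∀ z ∈ s, ‖lam - z‖ ≤ 3 * if z ∈ A then ε else 1) :
    (s.map fun z => ‖lam - z‖).prod ≤ 3 ^ s.card * ε ^ s.countP (fun z => z ∈ A) := by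
  induction s using Multiset.induction_on with
  | empty => simp
  | cons z s ih =>
    rw [Multiset.map_cons, Multiset.prod_cons]
    have h1 := hs z (Multiset.mem_cons_self z s)
    have h2 := ih fun y hy => hs y (Multiset.mem_cons_of_mem hy)
    have h3 : 0 ≤ (s.map fun z => ‖lam - z‖).prod :=
      Multiset.prod_nonneg fun _ hx => by
        obtain ⟨y, -, rfl⟩ := Multiset.mem_map.1 hx
        exact norm_nonneg _
    refine (mul_le_mul h1 h2 h3 (by split_ifs <;> positivity)).trans_eq ?_
    by_cases hz : z ∈ A
    · simp [hz]; ring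
    · simp [hz]; ring

/-- A unitary matrix with many eigenvalues in a short arc is close to singular after subtracting
a suitable scalar of norm slightly larger than `1`. -/
theorem exists_scalar_det_le {n k : ℕ} (g : Matrix.unitaryGroup (Fin n) ℂ) {A : Set ℂ}
    (hA : IsArc A) {ε : ℝ} (hε : 0 < ε) (hε1 : ε ≤ 1) (hdiam : Metric.diam A ≤ 2 * ε)
    (hk : k ≤ eigenvalueCount (g : Matrix (Fin n) (Fin n) ℂ) A) :
    ∃ (lam : ℂ) (M : Matrix (Fin n) (Fin n) ℂ),
      (∀ v, Matrix.toEuclideanLin M v = unitaryAct n g v - lam • v) ∧ M.det ≠ 0 ∧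
      ‖M.det‖ ≤ 3 ^ n * ε ^ k ∧ ∀ v, ε * ‖v‖ ≤ ‖Matrix.toEuclideanLin M v‖ := by
  classical
  obtain ⟨a, b, hab, hAeq⟩ := hA
  set ζ : ℂ := Complex.exp (a * Complex.I) with hζ
  have hζA : ζ ∈ A := by rw [hAeq]; exact ⟨a, ⟨le_rfl, hab⟩, rfl⟩
  have hζ1 : ‖ζ‖ = 1 := Complex.norm_exp_ofReal_mul_I a
  have hbdd : Bornology.IsBounded A := by
    rw [hAeq]
    exact (isCompact_Icc.image (by fun_prop)).isBounded
  -- Moving radially out by `ε` puts `lam` at distance at least `ε` from the circle, yet within `2ε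
  -- + ε = 3ε` of every eigenvalue in `A`; all other eigenvalues are within `2 + ε ≤ 3`.
  set lam : ℂ := ((1 + ε : ℝ) : ℂ) * ζ with hlam
  have hlam1 : ‖lam‖ = 1 + ε := by
    rw [hlam, norm_mul, hζ1, mul_one, Complex.norm_real, Real.norm_eq_abs,
      abs_of_pos (by linarith)]
  set G : Matrix (Fin n) (Fin n) ℂ := Subtype.val g with hG
  set M : Matrix (Fin n) (Fin n) ℂ := G - Matrix.scalar (Fin n) lam with hM
  have hMv : ∀ v, Matrix.toEuclideanLin M v = unitaryAct n g v - lam • v := by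
    intro v
    rw [hM, map_sub, LinearMap.sub_apply, unitaryAct_apply]
    congr 1
    ext i
    change ((Matrix.scalar (Fin n) lam).mulVec v.ofLp) i = _
    simp [Matrix.scalar_apply, Matrix.mulVec_diagonal]
  have hnormdet : ‖M.det‖ = (G.charpoly.roots.map fun z => ‖lam - z‖).prod := by
    have h1 : ‖M.det‖ = ‖(Matrix.scalar (Fin n) lam - G).det‖ := by
      rw [hM, ← neg_sub, Matrix.det_neg]
      simp
    rw [h1, ← Matrix.eval_charpoly,
      (IsAlgClosed.splits G.charpoly).eval_eq_prod_roots_of_monic (Matrix.charpoly_monic G)]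
    refine (map_multiset_prod (normHom : ℂ →*₀ ℝ) _).trans ?_
    rw [Multiset.map_map]
    rfl
  have hroot : ∀ z ∈ G.charpoly.roots, ‖z‖ = 1 := fun z hz =>
    norm_eq_one_of_mem_roots_charpoly g hz
  refine ⟨lam, M, hMv, ?_, ?_, fun v => ?_⟩
  · rw [← norm_ne_zero_iff, hnormdet]
    refine Multiset.prod_ne_zero fun h => ?_
    obtain ⟨z, hz, h0⟩ := Multiset.mem_map.1 h
    have h1 : lam = z := sub_eq_zero.1 (norm_eq_zero.1 h0)
    have h2 := hroot z hz
    rw [← h1, hlam1] at h2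
    linarith
  · rw [hnormdet]
    refine (prod_norm_sub_le (A := A) hε.le _ fun z hz => ?_).trans ?_
    · by_cases hzA : z ∈ A
      · have h1 : ‖ζ - z‖ ≤ 2 * ε := by
          rw [← dist_eq_norm]; exact (Metric.dist_le_diam_of_mem hbdd hζA hzA).trans hdiam
        have h2 : lam - z = (ζ - z) + (ε : ℂ) * ζ := by rw [hlam]; push_cast; ring
        have h3 : ‖(ε : ℂ) * ζ‖ = ε := by
          rw [norm_mul, hζ1, mul_one, Complex.norm_real, Real.norm_eq_abs, abs_of_pos hε]
        rw [if_pos hzA, h2]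
        refine (norm_add_le _ _).trans ?_
        linarith
      · rw [if_neg hzA]
        refine (norm_sub_le _ _).trans ?_
        rw [hlam1, hroot z hz]
        linarith
    · have hcard : G.charpoly.roots.card = n := by
        rw [← (IsAlgClosed.splits G.charpoly).natDegree_eq_card_roots,
          Matrix.charpoly_natDegree_eq_dim, Fintype.card_fin]
      rw [hcard]
      gcongr ?_ * ?_
      refine pow_le_pow_of_le_one hε.le hε1 (hk.trans (le_of_eq ?_))
      unfold eigenvalueCount
      congr!
  · rw [hMv]
    have h1 := norm_sub_norm_le (lam • v) (unitaryAct n g v)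
    rw [norm_smul, hlam1, LinearIsometryEquiv.norm_map, norm_sub_rev] at h1
    linarith

/-! ### Choice of the exponents -/

/-- The largest exponents for `m` trajectories of `L` points, starting in dimension `N`. -/
def trajectoryExponents (n L : ℕ) : ℕ → ℕ → List ℕ
  | _, 0 => []
  | N, m + 1 => (n - (N + L)) :: trajectoryExponents n L (N + L) m

theorem length_trajectoryExponents (n L N m : ℕ) :
    (trajectoryExponents n L N m).length = m := by
  induction m generalizing N with
  | zero => rfl
  | succ m ih => simp [trajectoryExponents, ih]

theorem fitsDimension_trajectoryExponents {n L N m : ℕ} (h : N + m * L ≤ n) :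
    FitsDimension n L N (trajectoryExponents n L N m) := by
  induction m generalizing N with
  | zero => trivial
  | succ m ih =>
    rw [add_mul, one_mul] at h
    exact ⟨by omega, ih (by omega)⟩

/-- For the `j`-th exponent `c = n - (N + jL)` one has `ε^(2n-2c) = ε^(2(N+jL))`; summing over `1 ≤
j ≤ m` gives the power of `ε`. Here `δ` plays the role of `|det M|`. -/
theorem le_prod_trajectoryExponents {n L N m k : ℕ} (h : N + m * L ≤ n) {ε δ : ℝ} (hε : 0 < ε)
    (hδ0 : 0 < δ) (hδ : δ ≤ 3 ^ n * ε ^ k) :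
    ENNReal.ofReal (((9 ^ n * ε ^ (2 * k)) ^ m)⁻¹ * ε ^ (2 * m * N + L * m * (m + 1))) ≤
      ((trajectoryExponents n L N m).map fun c =>
        ENNReal.ofReal (ε ^ (2 * n) * (ε ^ (2 * c))⁻¹ * (δ ^ 2)⁻¹)).prod := by
  induction m generalizing N with
  | zero => simp [trajectoryExponents]
  | succ m ih =>
    rw [add_mul, one_mul] at h
    rw [trajectoryExponents, List.map_cons, List.prod_cons]
    refine le_trans ?_ (mul_le_mul_right (ih (N := N + L) (by omega)) _)
    rw [← ENNReal.ofReal_mul (by positivity)]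
    refine ENNReal.ofReal_le_ofReal ?_
    have h1 : ε ^ (2 * n) * (ε ^ (2 * (n - (N + L))))⁻¹ = ε ^ (2 * (N + L)) := by
      rw [← div_eq_mul_inv, div_eq_iff (by positivity), ← pow_add]
      congr 1; omega
    have h2 : (9 ^ n * ε ^ (2 * k))⁻¹ ≤ (δ ^ 2)⁻¹ := by
      gcongr
      calc δ ^ 2 ≤ (3 ^ n * ε ^ k) ^ 2 := by gcongr
        _ = 9 ^ n * ε ^ (2 * k) := by
          rw [mul_pow, ← pow_mul, ← pow_mul, mul_comm n 2, pow_mul, mul_comm k 2]; norm_num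
    rw [h1]
    calc ((9 ^ n * ε ^ (2 * k)) ^ (m + 1))⁻¹ *
          ε ^ (2 * (m + 1) * N + L * (m + 1) * (m + 1 + 1))
        = ε ^ (2 * (N + L)) * (9 ^ n * ε ^ (2 * k))⁻¹ *
          (((9 ^ n * ε ^ (2 * k)) ^ m)⁻¹ * ε ^ (2 * m * (N + L) + L * m * (m + 1))) := by
          rw [show 2 * (m + 1) * N + L * (m + 1) * (m + 1 + 1) =
            2 * (N + L) + (2 * m * (N + L) + L * m * (m + 1)) by ring, pow_add ε (2 * (N + L)),
            pow_succ, mul_inv]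
          ring
      _ ≤ _ := by gcongr

/-- This compares base-`2` logarithms, with `ε = 2^(-a)`. Let `X` be the exponent of `ε` from
Markov's inequality. Since `L(m+1) ≤ 3k/2`, one gets `X ≥ mk/2`, whence `2LmT < kX` and `T < X`.
Then `aT ≥ 3n²` makes `a(X - T)` large enough to absorb `6nLm`, which exceeds `3nLm + 4nm` because
`L ≥ 2`. -/
theorem exponent_bound_lt {n L k m a T : ℝ} (hL : 2 ≤ L) (hm : 1 ≤ m) (hkL : 2 * L ≤ k)
    (hkn : k ≤ n) (hmL : L * m ≤ k) (hmL2 : k < L * m + L) (hT0 : 0 < T)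
    (hT : 4 * L * T < k ^ 2) (haT : 3 * n ^ 2 ≤ a * T) :
    3 * n * L * m + 4 * n * m - a * (2 * k * m - L * m * (m + 1)) < 3 * n ^ 2 - a * T := by
  have hk0 : 0 < k := by linarith
  have hn0 : 0 < n := by linarith
  obtain ⟨X, hX⟩ : ∃ X, X = 2 * k * m - L * m * (m + 1) := ⟨_, rfl⟩
  rw [← hX]
  have hX1 : m * k / 2 ≤ X := by
    have h1 : 0 ≤ m * (3 / 2 * k - (L * m + L)) := mul_nonneg (by linarith) (by linarith)
    rw [hX]
    linarith
  have hTX : T * (2 * L * m) < X * k := by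
    have h1 : 4 * L * T * (m / 2) < k ^ 2 * (m / 2) := mul_lt_mul_of_pos_right hT (by linarith)
    have h2 : m * k / 2 * k ≤ X * k := mul_le_mul_of_nonneg_right hX1 hk0.le
    linarith
  have hTX2 : T < X := by
    have h1 : L * 1 ≤ L * m := mul_le_mul_of_nonneg_left hm (by linarith)
    have h2 : T * k ≤ T * (2 * L * m) := mul_le_mul_of_nonneg_left (by linarith) hT0.le
    exact lt_of_mul_lt_mul_right (h2.trans_lt hTX) hk0.le
  have h1 : 3 * n ^ 2 * (X - T) ≤ a * T * (X - T) :=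
    mul_le_mul_of_nonneg_right haT (by linarith)
  have h3 : 6 * n * L * m * T ≤ 3 * n ^ 2 * X := by
    have h4 : 3 * n * (T * (2 * L * m)) ≤ 3 * n * (X * k) :=
      mul_le_mul_of_nonneg_left hTX.le (by linarith)
    have h5 : 3 * n * (X * k) ≤ 3 * n * (X * n) :=
      mul_le_mul_of_nonneg_left (mul_le_mul_of_nonneg_left hkn (by linarith)) (by linarith)
    linarith
  have hmain : 6 * n * L * m ≤ 3 * n ^ 2 + a * (X - T) := by
    refine le_of_mul_le_mul_right (a := T) ?_ hT0
    linarith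
  have hnm : 0 < n * m := mul_pos hn0 (by linarith)
  have hlast : 2 * (n * m) ≤ L * (n * m) := mul_le_mul_of_nonneg_right hL hnm.le
  linarith

theorem final_bound_lt {n L k m : ℕ} {ε T : ℝ} (hε : 0 < ε) (hL : 2 ≤ L) (hkn : k ≤ n)
    (hkL : 2 * L ≤ k) (hm : m = k / L) (hT0 : 0 < T) (hT : 4 * L * T < k ^ 2)
    (hsmall : (2 : ℝ) ^ (3 * n ^ 2) * ε ^ T ≤ 1) :
    8 ^ (n * L * m) * ((9 ^ n * ε ^ (2 * k)) ^ m * (ε ^ (L * m * (m + 1)))⁻¹) <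
      (2 : ℝ) ^ (3 * n ^ 2) * ε ^ T := by
  have hLpos : 0 < L := by omega
  have hmL : L * m ≤ k := by rw [hm]; exact Nat.mul_div_le k L
  have hmL2 : k < L * m + L := by
    rw [hm]; exact Nat.lt_mul_div_succ k hLpos
  have hm1 : 1 ≤ m := by
    rw [hm]; exact (Nat.le_div_iff_mul_le hLpos).2 (by omega)
  obtain ⟨a, rfl⟩ : ∃ a : ℝ, ε = 2 ^ (-a) := ⟨-Real.logb 2 ε, by
    rw [neg_neg, Real.rpow_logb (by norm_num) (by norm_num) hε]⟩
  have h2 : (1 : ℝ) < 2 := by norm_num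
  have e1 : (2 : ℝ) ^ (3 * n ^ 2) = 2 ^ (3 * (n : ℝ) ^ 2) := by
    rw [← Real.rpow_natCast]; push_cast; rfl
  have e2 : (2 : ℝ) ^ (3 * n ^ 2) * ((2 : ℝ) ^ (-a)) ^ T = 2 ^ (3 * (n : ℝ) ^ 2 - a * T) := by
    rw [e1, ← Real.rpow_mul (by norm_num), ← Real.rpow_add (by norm_num)]
    congr 1; ring
  have hpowa : ∀ j : ℕ, ((2 : ℝ) ^ (-a)) ^ j = 2 ^ (-a * j) := fun j => by
    rw [Real.rpow_mul (by norm_num), Real.rpow_natCast]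
  have h9 : (9 : ℝ) ^ (n * m) ≤ 2 ^ (4 * (n : ℝ) * m) := by
    calc (9 : ℝ) ^ (n * m) ≤ 16 ^ (n * m) := by gcongr; norm_num
      _ = 2 ^ (4 * (n * m)) := by rw [pow_mul 2 4]; norm_num
      _ = _ := by rw [← Real.rpow_natCast]; push_cast; ring_nf
  have h8 : (8 : ℝ) ^ (n * L * m) = 2 ^ (3 * (n : ℝ) * L * m) := by
    rw [show (8 : ℝ) = 2 ^ 3 by norm_num, ← pow_mul, ← Real.rpow_natCast]
    push_cast; ring_nf
  have hlhs : (8 : ℝ) ^ (n * L * m) * ((9 ^ n * ((2 : ℝ) ^ (-a)) ^ (2 * k)) ^ m *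
      (((2 : ℝ) ^ (-a)) ^ (L * m * (m + 1)))⁻¹) ≤
      2 ^ (3 * (n : ℝ) * L * m + 4 * n * m - a * (2 * k * m - L * m * (m + 1))) := by
    rw [mul_pow, ← pow_mul, ← pow_mul, hpowa, hpowa, h8, ← Real.rpow_neg (by norm_num)]
    calc (2 : ℝ) ^ (3 * (n : ℝ) * L * m) * (9 ^ (n * m) * 2 ^ (-a * ↑(2 * k * m)) *
          2 ^ (-(-a * ↑(L * m * (m + 1)))))
        ≤ (2 : ℝ) ^ (3 * (n : ℝ) * L * m) * (2 ^ (4 * (n : ℝ) * m) * 2 ^ (-a * ↑(2 * k * m)) *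
          2 ^ (-(-a * ↑(L * m * (m + 1))))) := by gcongr
      _ = _ := by
        rw [← Real.rpow_add (by norm_num), ← Real.rpow_add (by norm_num),
          ← Real.rpow_add (by norm_num)]
        congr 1; push_cast; ring
  rw [e2] at hsmall ⊢
  -- This is the assumption that the target bound is at most `1`, in logarithmic form.
  have haT : 3 * (n : ℝ) ^ 2 ≤ a * T := by
    have h := (Real.rpow_le_one_iff_of_pos (by norm_num : (0 : ℝ) < 2)).1 hsmall
    rcases h with ⟨_, h⟩ | ⟨h, _⟩
    · linarith
    · norm_num at h
  refine hlhs.trans_lt ((Real.rpow_lt_rpow_left_iff h2).2 ?_)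
  have rL : (2 : ℝ) ≤ L := by exact_mod_cast hL
  have rk : (k : ℝ) ≤ n := by exact_mod_cast hkn
  have rm : (1 : ℝ) ≤ m := by exact_mod_cast hm1
  have rkL : 2 * (L : ℝ) ≤ k := by exact_mod_cast hkL
  have rmL : (L : ℝ) * m ≤ k := by exact_mod_cast hmL
  have rmL2 : (k : ℝ) < L * m + L := by exact_mod_cast hmL2
  exact exponent_bound_lt rL rm rkL rk rmL rmL2 hT0 hT haT

/-! ### Markov's inequality and the conclusion -/

theorem isReduced_reverse {α : Type*} {w : List (α × Bool)} (hw : FreeGroup.IsReduced w) :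
    FreeGroup.IsReduced w.reverse := by
  rw [FreeGroup.IsReduced, List.isChain_reverse]
  exact hw.imp fun _ _ h h' => (h h'.symm).symm

theorem freeGroup_lift_eq_prod_letterValue {n r : ℕ}
    (g : Fin r → Matrix.unitaryGroup (Fin n) ℂ) (w : FreeGroup (Fin r)) :
    FreeGroup.lift g w = (w.toWord.map (letterValue g)).prod := by
  conv_lhs => rw [← FreeGroup.mk_toWord (x := w), FreeGroup.lift_mk]
  rfl

theorem lintegral_totalWeight_pi_le {n r m : ℕ} {w : List (Fin r × Bool)}
    (hw : FreeGroup.IsReduced w) (hm : m * (w.length + 1) ≤ n) :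
    ∫⁻ g, totalWeight g w (trajectoryExponents n (w.length + 1) 0 m) ⊥
      ∂(Measure.pi fun _ : Fin r => haarUnitary n) ≤ (8 ^ n) ^ ((w.length + 1) * m) := by
  have h0 : flagStabilizer n (0 : Fin r → ℕ) = ⊤ :=
    eq_top_iff.2 fun _ _ _ _ hi => absurd hi (by simp)
  rw [(isSubgroupHaar_flagHaar n (0 : Fin r → ℕ)).lintegral_eq_of_isMulLeftInvariant _ h0
    (f := fun g => totalWeight g w (trajectoryExponents n (w.length + 1) 0 m) ⊥)
    (measurable_totalWeight w _ measurable_id (IsMeasurableSpan.const ⊥))]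
  have h := IsConditionedHaar.flagHaar_zero.lintegral_totalWeight_le (N := 0) (V := ⊥) hw
    (trajectoryExponents n (w.length + 1) 0 m)
    (fitsDimension_trajectoryExponents (by omega)) (fun _ => ⟨le_rfl, le_rfl⟩) (by simp)
  rwa [length_trajectoryExponents] at h

/-- Small ball estimate for word maps on unitary groups. -/
theorem measure_pi_not_isSpread_le {n r k m : ℕ} (w : FreeGroup (Fin r)) (hw : 1 ≤ w.norm)
    {β ε : ℝ} (hk : ∀ j : ℕ, (1 - β) * n < j → k ≤ j) (hε : 0 < ε) (hε1 : ε ≤ 1)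
    (hm : m * (w.norm + 1) ≤ n) :
    ∃ S : Set (Fin r → Matrix.unitaryGroup (Fin n) ℂ), MeasurableSet S ∧
      {g | ¬ IsSpread β ε (FreeGroup.lift g w)} ⊆ S ∧
      (Measure.pi fun _ : Fin r => haarUnitary n) S ≤
        ENNReal.ofReal (8 ^ (n * (w.norm + 1) * m) * ((9 ^ n * ε ^ (2 * k)) ^ m *
          (ε ^ ((w.norm + 1) * m * (m + 1)))⁻¹)) := by
  set L := w.norm + 1 with hL
  -- A product of matrices acts with its rightmost letter first.
  set l := w.toWord.reverse with hl
  have hlen : l.length + 1 = L := by simp [hl, hL, FreeGroup.norm]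
  have hlne : l ≠ [] := by
    intro h
    rw [h] at hlen
    simp at hlen
    omega
  have hred : FreeGroup.IsReduced l := isReduced_reverse FreeGroup.isReduced_toWord
  set cs := trajectoryExponents n L 0 m with hcs
  set b : ℝ := ((9 ^ n * ε ^ (2 * k)) ^ m)⁻¹ * ε ^ (L * m * (m + 1)) with hb
  have hbpos : 0 < b := by positivity
  have hmeas : Measurable fun g : Fin r → Matrix.unitaryGroup (Fin n) ℂ =>
      totalWeight g l cs ⊥ :=
    measurable_totalWeight l cs measurable_id (IsMeasurableSpan.const ⊥)
  -- A superlevel set of the measurable total weight contains the non-spread event, so measurability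
  -- of that event is not needed.
  refine ⟨{g | ENNReal.ofReal b ≤ totalWeight g l cs ⊥},
    measurableSet_le measurable_const hmeas, ?_, ?_⟩
  · intro g hg
    have hg' : ¬ IsSpread β ε (FreeGroup.lift g w) := hg
    rw [IsSpread] at hg'
    push Not at hg'
    obtain ⟨A, hA, hdiam, hcount⟩ := hg'
    obtain ⟨lam, M, hM, hdet, hdetle, hMε⟩ :=
      exists_scalar_det_le (FreeGroup.lift g w) hA hε hε1 hdiam (hk _ hcount)
    have h1 := le_totalWeight g hlne lam (M := M) (fun v => by
      rw [hM, walkEnd_eq, hl, List.reverse_reverse, freeGroup_lift_eq_prod_letterValue])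
      hdet hε hMε cs ⊥
    refine le_trans ?_ h1
    have h2 := le_prod_trajectoryExponents (N := 0) (L := L) (m := m) (n := n) (k := k)
      (by omega) hε (norm_pos_iff.2 hdet) hdetle
    simpa [hb] using h2
  · have h1 := mul_meas_ge_le_lintegral (μ := Measure.pi fun _ : Fin r => haarUnitary n) hmeas
      (ENNReal.ofReal b)
    have h2 := lintegral_totalWeight_pi_le (n := n) (r := r) (m := m) hred (by rw [hlen]; exact hm)
    rw [hlen] at h2
    have h3 := h1.trans h2
    rw [mul_comm] at h3
    have hb0 : ENNReal.ofReal b ≠ 0 := by simpa using hbpos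
    refine ((ENNReal.le_div_iff_mul_le (Or.inl hb0) (Or.inl ENNReal.ofReal_ne_top)).2 h3).trans_eq
      ?_
    rw [show (8 : ENNReal) = ENNReal.ofReal 8 by simp, ← ENNReal.ofReal_pow (by norm_num),
      ← ENNReal.ofReal_pow (by norm_num), ← ENNReal.ofReal_div_of_pos hbpos]
    congr 1
    rw [hb, div_eq_mul_inv, mul_inv, inv_inv, ← pow_mul, mul_assoc n]

theorem mainTheorem5 {Ω : Type*} [MeasurableSpace Ω] (P : Measure Ω) [IsProbabilityMeasure P]
    (r n : ℕ) (w : FreeGroup (Fin r)) (hw : 1 ≤ w.norm)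
    (β : ℝ) (hβ0 : 0 < β) (hβ1 : β < 1)
    (hn : max (4 * (w.norm : ℝ) / (1 - β)) (max (8 / (1 - β)) 16) < (n : ℝ))
    (G : Fin r → Ω → Matrix.unitaryGroup (Fin n) ℂ)
    (hGlaw : ∀ i, HasLaw (G i) (haarUnitary n) P)
    (hGindep : iIndepFun G P)
    (ε : ℝ) (hε : 0 < ε) :
    P.real {ω | ¬ IsSpread β ε (FreeGroup.lift (fun i => G i ω) w)} <
      (2 : ℝ) ^ (3 * n ^ 2) *
        ε ^ ((n : ℝ) ^ 2 * (1 - β) ^ 2 / (4 * ((w.norm : ℝ) + 1))) := by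
  set T : ℝ := (n : ℝ) ^ 2 * (1 - β) ^ 2 / (4 * ((w.norm : ℝ) + 1)) with hT
  -- A bound above `1` is trivial. In the other case `ε ≤ 1`, and `ε` is small enough for the
  -- exponent comparison.
  rcases lt_or_ge 1 ((2 : ℝ) ^ (3 * n ^ 2) * ε ^ T) with hbig | hsmall
  · exact measureReal_le_one.trans_lt hbig
  have hβ : 0 < 1 - β := by linarith
  have hn1 : 4 * (w.norm : ℝ) < (1 - β) * n := by
    have h := (le_max_left _ _).trans_lt hn
    rwa [div_lt_iff₀ hβ, mul_comm (n : ℝ)] at h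
  have hn0 : (0 : ℝ) < n := by
    have h := ((le_max_right _ _).trans (le_max_right _ _)).trans_lt hn
    linarith
  have hT0 : 0 < T := by positivity
  have hε1 : ε ≤ 1 := by
    by_contra hcon
    have h1 : 1 < ε ^ T := Real.one_lt_rpow (not_le.1 hcon) hT0
    have h2 : (1 : ℝ) ≤ 2 ^ (3 * n ^ 2) := one_le_pow₀ (by norm_num)
    nlinarith
  set κ : ℝ := (1 - β) * n with hκ
  have hκ0 : 0 ≤ κ := by positivity
  have hκn : κ < n := by rw [hκ]; nlinarith
  -- The least integer strictly above `(1 - β) n`, hence a lower bound for the eigenvalue count in a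
  -- violating arc.
  set k := ⌊κ⌋₊ + 1 with hk
  have hκk : κ < k := by rw [hk]; exact_mod_cast Nat.lt_floor_add_one κ
  have hkj : ∀ j : ℕ, κ < j → k ≤ j := fun j hj => (Nat.floor_lt hκ0).2 hj
  have hkn : k ≤ n := hkj n hκn
  have hk4 : 4 * w.norm < k := by
    have : (4 * w.norm : ℝ) < k := hn1.trans hκk
    exact_mod_cast this
  -- This integer maximizes `2km - Lm(m+1)`, whose real maximum is at `k/L - 1/2`.
  set m := k / (w.norm + 1) with hm
  have hmL : m * (w.norm + 1) ≤ n := (Nat.div_mul_le_self _ _).trans hkn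
  obtain ⟨S, hS, hsub, hSle⟩ := measure_pi_not_isSpread_le (m := m) w hw hkj hε hε1 hmL
  have hae : ∀ i, AEMeasurable (G i) P := fun i => (hGlaw i).aemeasurable
  have hlaw : P.map (fun ω i => G i ω) = Measure.pi fun _ : Fin r => haarUnitary n := by
    rw [(iIndepFun_iff_map_fun_eq_pi_map hae).1 hGindep]
    congr 1
    funext i
    exact (hGlaw i).map_eq
  have hP : P {ω | ¬ IsSpread β ε (FreeGroup.lift (fun i => G i ω) w)} ≤
      (Measure.pi fun _ : Fin r => haarUnitary n) S := by
    rw [← hlaw, Measure.map_apply_of_aemeasurable (aemeasurable_pi_lambda _ hae) hS]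
    exact measure_mono fun ω hω => hsub hω
  have hreal := ENNReal.toReal_mono ENNReal.ofReal_ne_top (hP.trans hSle)
  rw [ENNReal.toReal_ofReal (by positivity)] at hreal
  refine lt_of_le_of_lt hreal (final_bound_lt hε (by omega) hkn (by omega) hm hT0 ?_ hsmall)
  -- The strict inequality `4LT < k²` comes from `κ < k`, that is, from rounding up strictly.
  have h1 : 4 * ((w.norm + 1 : ℕ) : ℝ) * T = κ ^ 2 := by
    rw [hT, hκ]; push_cast; field_simp
  rw [h1]
  gcongr
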